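/- All graphs are finite and simple. For a graph $G$, let $\Delta=\Delta(G)$ be its maximum degree, $d_G(x)$ the degree of a vertex $x$, and $\chi'(G)$ its chromatic index, i.e. the smallest integer $k$ such that the edges of $G$ can be colored with $k$ colors so that no two adjacent edges receive the same color. The graph $G$ is of class 1 if $\chi'(G)=\Delta(G)$, and of class 2 otherwise. An edge $e$ of $G$ is critical if $\chi'(G-e)<\chi'(G)$, where $G-e$ is obtained from $G$ by deleting $e$. A pair $(a,b)$ of adjacent vertices of $G$ is a full-deficiency pair of $G$ if $d_G(a)+d_G(b)=\Delta(G)+2$. Corollary 3.4. Let $G$ be an $n$-vertex class 2 graph with a full-deficiency pair $(a,b)$ such that $ab$ is a critical edge of $G$. If $\Delta\ge \frac{3(n-1)}{4}$, then there exists at most one vertex $x\in V(G)\setminus\{a,b\}$ such that $d_G(x)=\Delta-1$. -/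

import Mathlib

namespace SimpleGraph

variable {V : Type*}

/-- An edge `k`-coloring of `G`: a map from the edges of `G` to a set of `k` colors such that no two
adjacent edges (distinct edges sharing an endpoint) receive the same color, that is, a proper
vertex coloring of the line graph. -/
abbrev EdgeColoring (G : SimpleGraph V) (k : ℕ) : Type _ :=
  G.lineGraph.Coloring (Fin k)

/-- The chromatic index: the smallest `k` such that `G` has an edge `k`-coloring.
(For a finite graph the set is nonempty, see `exists_edgeColoring`.) -/
noncomputable def chromaticIndex (G : SimpleGraph V) : ℕ :=
  sInf {k : ℕ | Nonempty (G.EdgeColoring k)}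

theorem exists_edgeColoring [Finite V] (G : SimpleGraph V) :
    {k : ℕ | Nonempty (G.EdgeColoring k)}.Nonempty := by
  obtain ⟨k, ⟨f⟩⟩ := Finite.exists_equiv_fin G.edgeSet
  exact ⟨k, ⟨Coloring.mk f (fun h he => h.ne (f.injective he))⟩⟩

/-- `G` is of class 1 if its chromatic index equals its maximum degree. -/
def IsClassOne (G : SimpleGraph V) [Fintype V] [DecidableRel G.Adj] : Prop :=
  G.chromaticIndex = G.maxDegree

/-- `G` is of class 2 if it is not of class 1. -/
def IsClassTwo (G : SimpleGraph V) [Fintype V] [DecidableRel G.Adj] : Prop :=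
  ¬ G.IsClassOne

/-- `e` is a critical edge of `G`: it is an edge whose deletion decreases the chromatic index. -/
def IsCriticalEdge (G : SimpleGraph V) (e : Sym2 V) : Prop :=
  e ∈ G.edgeSet ∧ (G.deleteEdges {e}).chromaticIndex < G.chromaticIndex

/-- `(u, v)` is a full-deficiency pair of `G`: `u` and `v` are adjacent and
`d(u) + d(v) = Δ(G) + 2`. -/
def IsFullDeficiencyPair (G : SimpleGraph V) [Fintype V] [DecidableRel G.Adj] (u v : V) : Prop :=
  G.Adj u v ∧ G.degree u + G.degree v = G.maxDegree + 2

end SimpleGraph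

/-! Criticality of `ab` and class 2 give a proper colouring of `G - ab` with Δ colours. Since `d(a)
+ d(b) = Δ + 2`, the sets of colours missing at `a` and at `b` partition all colours: they are
disjoint, or `ab` could be coloured, and their sizes add up to Δ. Hence for p missing at `a` and q
missing at `b`, one (p,q)-chain joins `a` to `b`, and the chain ending at any third vertex can be
exchanged without touching the edges at `a` and `b` (`exists_switch`). Every local argument rests on
this freedom.

A vertex of degree Δ - 1 misses a colour, so it suffices to limit the vertices that can. Neighbours
of `a` or `b` other than `a`, `b` miss nothing (`not_misses_of_adj_left`). If `d(b) < Δ`, then `b`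
misses two colours, and vertices at the end of a path `b, u, x` miss nothing either
(`not_misses_of_path`). When both degrees are below Δ, the larger one is at least Δ/2 + 1, and a
count of neighbourhoods produces such a path to any vertex of degree Δ - 1.

Otherwise one of them, say `b`, has degree Δ and `a` has degree two. Two vertices `x`, `y` of degree
Δ - 1 would then share a neighbour `u` with `b`, which `broom` excludes: uncolour the stars at `a`
and `u`, and exchange Kempe chains among four colours until both stars can be coloured again. Only
finitely many patterns of missing colours and chain connections occur, and `isWinning_states` checks
them all by evaluation. -/

namespace SimpleGraph

/-! ### Edge colourings as functions on pairs, recolouring, and Kempe exchanges. -/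

section Proper

variable {V : Type*} {k : ℕ}

/-- `φ` restricts to a proper edge colouring of `R`; its values off the edges are irrelevant. -/
structure IsProperEdge (R : SimpleGraph V) (φ : V → V → Fin k) : Prop where
  symm : ∀ v w, φ v w = φ w v
  inj : ∀ ⦃v w w'⦄, R.Adj v w → R.Adj v w' → φ v w = φ v w' → w = w'

/-- No edge of `R` at `v` has colour `i`. -/
def Misses (R : SimpleGraph V) (φ : V → V → Fin k) (v : V) (i : Fin k) : Prop :=
  ∀ w, R.Adj v w → φ v w ≠ i

theorem IsProperEdge.mono {R S : SimpleGraph V} {φ : V → V → Fin k} (h : S.IsProperEdge φ)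
    (hRS : R ≤ S) : R.IsProperEdge φ :=
  ⟨h.symm, fun _ _ _ h₁ h₂ => h.inj (hRS h₁) (hRS h₂)⟩

theorem Misses.mono {R S : SimpleGraph V} {φ : V → V → Fin k} {v : V} {i : Fin k}
    (h : S.Misses φ v i) (hRS : R ≤ S) : R.Misses φ v i :=
  fun w hw => h w (hRS hw)

theorem exists_of_not_misses {R : SimpleGraph V} {φ : V → V → Fin k} {v : V} {i : Fin k}
    (h : ¬ R.Misses φ v i) : ∃ w, R.Adj v w ∧ φ v w = i := by
  simpa [Misses] using h

theorem nonempty_edgeColoring_of_isProperEdge {G : SimpleGraph V} {φ : V → V → Fin k}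
    (h : G.IsProperEdge φ) : Nonempty (G.EdgeColoring k) := by
  refine ⟨Coloring.mk (fun e => Sym2.lift ⟨φ, h.symm⟩ e.1) ?_⟩
  rintro ⟨e, he⟩ ⟨f, hf⟩ ⟨hne, v, hve, hvf⟩ heq
  simp only [SetLike.mem_coe] at hve hvf
  obtain ⟨x, rfl⟩ := hve
  obtain ⟨y, rfl⟩ := hvf
  simp only [Sym2.lift_mk] at heq
  obtain rfl : x = y := h.inj he hf heq
  exact hne rfl

theorem exists_isProperEdge_of_edgeColoring [NeZero k] {G : SimpleGraph V}
    (C : G.EdgeColoring k) : ∃ φ : V → V → Fin k, G.IsProperEdge φ := by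
  classical
  refine ⟨fun v w => if h : G.Adj v w then C ⟨s(v, w), h⟩ else 0, ?_, ?_⟩
  · intro v w
    by_cases h : G.Adj v w
    · simp only [h, h.symm, dif_pos]
      congr 2
      exact Sym2.eq_swap
    · have h' : ¬ G.Adj w v := fun h' => h h'.symm
      simp [h, h']
  · intro v w w' h h' heq
    simp only [h, h', dif_pos] at heq
    by_contra hne
    refine C.valid (v := ⟨s(v, w), h⟩) (w := ⟨s(v, w'), h'⟩) ⟨?_, v, ?_, ?_⟩ heq
    · intro e
      exact hne (Sym2.congr_right.1 (congrArg Subtype.val e))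
    · simp
    · simp

/-- The graph obtained from `G` by isolating `v`. -/
def isolate (G : SimpleGraph V) (v : V) : SimpleGraph V where
  Adj x y := G.Adj x y ∧ x ≠ v ∧ y ≠ v
  symm := ⟨fun _ _ h => ⟨h.1.symm, h.2.2, h.2.1⟩⟩
  loopless := ⟨fun _ h => h.1.ne rfl⟩

theorem isolate_le (G : SimpleGraph V) (v : V) : G.isolate v ≤ G := fun _ _ h => h.1

open Classical in
/-- Recolour the star at `v` by `g`. -/
noncomputable def recolorStar (φ : V → V → Fin k) (v : V) (g : V → Fin k) : V → V → Fin k :=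
  fun x y => if x = v then g y else if y = v then g x else φ x y

theorem IsProperEdge.recolorStar {G : SimpleGraph V} {φ : V → V → Fin k} {v : V} {g : V → Fin k}
    (h : (G.isolate v).IsProperEdge φ)
    (hg : ∀ ⦃w w'⦄, G.Adj v w → G.Adj v w' → g w = g w' → w = w')
    (hm : ∀ w, G.Adj v w → (G.isolate v).Misses φ w (g w)) :
    G.IsProperEdge (recolorStar φ v g) := by
  constructor
  · intro x y
    unfold SimpleGraph.recolorStar
    have := h.symm x y
    split_ifs <;> simp_all
  · intro x y z hy hz
    unfold SimpleGraph.recolorStar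
    by_cases hx : x = v
    · subst hx
      simpa using hg hy hz
    · simp only [hx, if_false]
      by_cases hyv : y = v <;> by_cases hzv : z = v
      · simp [hyv, hzv]
      · subst hyv
        simp only [hzv, if_true, if_false]
        intro e
        exact absurd e.symm (hm x hy.symm z ⟨hz, hx, hzv⟩)
      · subst hzv
        simp only [hyv, if_true, if_false]
        intro e
        exact absurd e (hm x hz.symm y ⟨hy, hx, hyv⟩)
      · simp only [hyv, hzv, if_false]
        exact h.inj ⟨hy, hx, hyv⟩ ⟨hz, hx, hzv⟩

open Classical in
/-- Recolour the edge `xy` by `i`. -/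
noncomputable def recolorEdge (φ : V → V → Fin k) (x y : V) (i : Fin k) : V → V → Fin k :=
  fun v w => if s(v, w) = s(x, y) then i else φ v w

/-- The inclusion `hG`, instead of an equality, covers two uses: colouring an edge absent from `H`,
and changing the colour of an edge that `H` already has. -/
theorem IsProperEdge.recolorEdge {H G : SimpleGraph V} {φ : V → V → Fin k} {x y : V} {i : Fin k}
    (h : H.IsProperEdge φ) (hG : G.deleteEdges {s(x, y)} ≤ H)
    (hx : H.Misses φ x i) (hy : H.Misses φ y i) : G.IsProperEdge (recolorEdge φ x y i) := by
  have key : ∀ v w, G.Adj v w → s(v, w) ≠ s(x, y) → H.Adj v w := fun v w hv hne =>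
    hG (by simpa [deleteEdges_adj] using ⟨hv, by simpa using hne⟩)
  have hm : ∀ v w w', s(v, w) = s(x, y) → G.Adj v w' → s(v, w') ≠ s(x, y) → φ v w' ≠ i := by
    intro v w w' e hv hne
    have hv' := key _ _ hv hne
    rcases Sym2.eq_iff.1 e with ⟨rfl, rfl⟩ | ⟨rfl, rfl⟩
    exacts [hx _ hv', hy _ hv']
  constructor
  · intro v w
    unfold SimpleGraph.recolorEdge
    rw [h.symm v w, Sym2.eq_swap]
  · intro v w w' hw hw' e
    unfold SimpleGraph.recolorEdge at e
    split_ifs at e with h₁ h₂ h₂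
    · have := h₁.trans h₂.symm
      exact Sym2.congr_right.1 this
    · exact absurd e.symm (hm _ _ _ h₁ hw' h₂)
    · exact absurd e (hm _ _ _ h₂ hw h₁)
    · exact h.inj (key _ _ hw h₁) (key _ _ hw' h₂) e

/-- The subgraph of the edges of colours `p` and `q`. -/
def kempeGraph (R : SimpleGraph V) (φ : V → V → Fin k) (hφ : ∀ v w, φ v w = φ w v)
    (p q : Fin k) : SimpleGraph V where
  Adj v w := R.Adj v w ∧ (φ v w = p ∨ φ v w = q)
  symm := ⟨fun v w h => ⟨h.1.symm, by rw [hφ w v]; exact h.2⟩⟩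
  loopless := ⟨fun _ h => h.1.ne rfl⟩

/-- `X` is a union of connected components of `K`. -/
def IsClosedUnder (K : SimpleGraph V) (X : Set V) : Prop :=
  ∀ ⦃v w⦄, K.Adj v w → (v ∈ X ↔ w ∈ X)

theorem isClosedUnder_reachable (K : SimpleGraph V) (v : V) :
    K.IsClosedUnder {w | K.Reachable v w} :=
  fun _ _ h => ⟨fun h' => h'.trans h.reachable, fun h' => h'.trans h.symm.reachable⟩

open Classical in
/-- Interchange the colours `p` and `q` on `X`. -/
noncomputable def kempeSwap (φ : V → V → Fin k) (p q : Fin k) (X : Set V) : V → V → Fin k :=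
  -- Testing both endpoints keeps the function symmetric. If `X` is closed, an edge leaving `X` has
  -- neither colour, so nothing is lost.
  fun v w => if v ∈ X ∧ w ∈ X then Equiv.swap p q (φ v w) else φ v w

variable {R : SimpleGraph V} {φ : V → V → Fin k} {p q : Fin k} {X : Set V}

theorem kempeSwap_of_mem (hφ : ∀ v w, φ v w = φ w v)
    (hX : (R.kempeGraph φ hφ p q).IsClosedUnder X) {v w : V} (h : R.Adj v w) (hv : v ∈ X) :
    kempeSwap φ p q X v w = Equiv.swap p q (φ v w) := by
  unfold kempeSwap
  split_ifs with hw
  · rfl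
  · have : ¬ (φ v w = p ∨ φ v w = q) := fun h' => hw ⟨hv, (hX ⟨h, h'⟩).1 hv⟩
    push Not at this
    rw [Equiv.swap_apply_of_ne_of_ne this.1 this.2]

theorem kempeSwap_of_notMem {v : V} (w : V) (hv : v ∉ X) :
    kempeSwap φ p q X v w = φ v w := by
  simp [kempeSwap, hv]

theorem IsProperEdge.kempeSwap (h : R.IsProperEdge φ)
    (hX : (R.kempeGraph φ h.symm p q).IsClosedUnder X) :
    R.IsProperEdge (kempeSwap φ p q X) := by
  constructor
  · intro v w
    unfold SimpleGraph.kempeSwap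
    rw [h.symm v w]
    by_cases hv : v ∈ X <;> by_cases hw : w ∈ X <;> simp [hv, hw]
  · intro v w w' hw hw' e
    by_cases hv : v ∈ X
    · rw [kempeSwap_of_mem h.symm hX hw hv, kempeSwap_of_mem h.symm hX hw' hv] at e
      exact h.inj hw hw' ((Equiv.swap p q).injective e)
    · rw [kempeSwap_of_notMem _ hv, kempeSwap_of_notMem _ hv] at e
      exact h.inj hw hw' e

theorem misses_kempeSwap_of_mem (hφ : ∀ v w, φ v w = φ w v)
    (hX : (R.kempeGraph φ hφ p q).IsClosedUnder X) {v : V} (hv : v ∈ X) (i : Fin k) :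
    R.Misses (kempeSwap φ p q X) v i ↔ R.Misses φ v (Equiv.swap p q i) := by
  refine forall₂_congr fun w hw => not_congr ?_
  rw [kempeSwap_of_mem hφ hX hw hv, Equiv.swap_apply_eq_iff]

theorem misses_kempeSwap_of_notMem {v : V} (hv : v ∉ X) (i : Fin k) :
    R.Misses (kempeSwap φ p q X) v i ↔ R.Misses φ v i :=
  forall₂_congr fun w _ => by rw [kempeSwap_of_notMem w hv]

theorem misses_kempeSwap_of_ne (hφ : ∀ v w, φ v w = φ w v)
    (hX : (R.kempeGraph φ hφ p q).IsClosedUnder X) (v : V) {i : Fin k} (hp : i ≠ p) (hq : i ≠ q) :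
    R.Misses (kempeSwap φ p q X) v i ↔ R.Misses φ v i := by
  by_cases hv : v ∈ X
  · rw [misses_kempeSwap_of_mem hφ hX hv, Equiv.swap_apply_of_ne_of_ne hp hq]
  · exact misses_kempeSwap_of_notMem hv i

theorem kempeSwap_eq_or (v w : V) :
    kempeSwap φ p q X v w = φ v w ∨ kempeSwap φ p q X v w = Equiv.swap p q (φ v w) := by
  unfold kempeSwap
  split_ifs <;> simp

/-- Interchanging two colours leaves the Kempe graph of a pair of colours unchanged if the pair is
the same or disjoint. -/
theorem kempeGraph_kempeSwap (hφ : ∀ v w, φ v w = φ w v)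
    (hφ' : ∀ v w, kempeSwap φ p q X v w = kempeSwap φ p q X w v) {r t : Fin k}
    (h : (∀ i, (Equiv.swap p q i = r ∨ Equiv.swap p q i = t) ↔ (i = r ∨ i = t))) :
    R.kempeGraph (kempeSwap φ p q X) hφ' r t = R.kempeGraph φ hφ r t := by
  ext v w
  refine and_congr_right fun _ => ?_
  rcases kempeSwap_eq_or (φ := φ) (p := p) (q := q) (X := X) v w with e | e <;> rw [e]
  exact h _

end Proper

/-! ### Kempe chains have at most two ends. -/

section ThreeEnds

variable {V : Type*} {K : SimpleGraph V}

/-- A connected component of a graph of maximum degree at most two has at most two vertices of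
degree at most one. -/
theorem not_three_ends [Finite V] (hK : ∀ v, (K.neighborSet v).ncard ≤ 2) {x y z : V} (hxy : x ≠ y)
    (hxz : x ≠ z) (hyz : y ≠ z) (hx : (K.neighborSet x).ncard ≤ 1)
    (hy : (K.neighborSet y).ncard ≤ 1) (hz : (K.neighborSet z).ncard ≤ 1)
    (h₁ : K.Reachable x y) (h₂ : K.Reachable x z) : False := by
  classical
  cases nonempty_fintype V
  set c := K.connectedComponentMk x with hc
  have hconn : c.toSimpleGraph.Connected := c.connected_toSimpleGraph
  have hcard := hconn.card_vert_le_card_edgeSet_add_one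
  have hdeg : ∀ v : c, c.toSimpleGraph.degree v ≤ (K.neighborSet v).ncard := by
    intro v
    rw [← card_neighborSet_eq_degree, ← Nat.card_eq_fintype_card, ← Nat.card_coe_set_eq]
    refine Nat.card_le_card_of_injective
      (fun w : c.toSimpleGraph.neighborSet v => (⟨w.1.1, w.2⟩ : K.neighborSet v)) ?_
    intro w w' h
    have h' : w.1.1 = w'.1.1 := congrArg (fun z : K.neighborSet v => z.1) h
    exact Subtype.ext (Subtype.ext h')
  have hsum := c.toSimpleGraph.sum_degrees_eq_twice_card_edges
  let X : c := ⟨x, rfl⟩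
  let Y : c := ⟨y, (ConnectedComponent.eq.2 h₁).symm⟩
  let Z : c := ⟨z, (ConnectedComponent.eq.2 h₂).symm⟩
  -- Three ends give degree sum at most 2|c| - 3, whereas connectedness forces at least 2|c| - 2.
  have hle : ∑ v : c, (c.toSimpleGraph.degree v + if v ∈ ({X, Y, Z} : Finset c) then 1 else 0)
      ≤ ∑ _v : c, 2 := by
    refine Finset.sum_le_sum fun v _ => ?_
    have h2 := (hdeg v).trans (hK v)
    split_ifs with hv
    · simp only [Finset.mem_insert, Finset.mem_singleton] at hv
      rcases hv with rfl | rfl | rfl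
      · have := (hdeg X).trans hx; omega
      · have := (hdeg Y).trans hy; omega
      · have := (hdeg Z).trans hz; omega
    · omega
  have h3 : ({X, Y, Z} : Finset c).card = 3 := by
    rw [Finset.card_eq_three]
    exact ⟨X, Y, Z, fun e => hxy (congrArg Subtype.val e), fun e => hxz (congrArg Subtype.val e),
      fun e => hyz (congrArg Subtype.val e), rfl⟩
  rw [Finset.sum_add_distrib, hsum, Finset.sum_ite_mem, Finset.univ_inter, Finset.sum_const, h3,
    Finset.sum_const, Finset.card_univ] at hle
  rw [Nat.card_eq_fintype_card, Nat.card_eq_fintype_card, ← edgeFinset_card] at hcard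
  simp only [smul_eq_mul] at hle
  omega

variable {k : ℕ} {R : SimpleGraph V} {φ : V → V → Fin k} {p q : Fin k}

theorem ncard_neighborSet_kempeGraph_le_two (h : R.IsProperEdge φ) (v : V) :
    ((R.kempeGraph φ h.symm p q).neighborSet v).ncard ≤ 2 := by
  have hle := Set.ncard_le_ncard_of_injOn (s := (R.kempeGraph φ h.symm p q).neighborSet v)
    (t := {p, q}) (φ v) (fun w hw => by simpa using hw.2)
    (fun w hw w' hw' e => h.inj hw.1 hw'.1 e)
  exact hle.trans ((Set.ncard_insert_le _ _).trans (by simp))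

theorem ncard_neighborSet_kempeGraph_le_one [Finite V] (h : R.IsProperEdge φ) {v : V}
    (hv : R.Misses φ v p ∨ R.Misses φ v q) :
    ((R.kempeGraph φ h.symm p q).neighborSet v).ncard ≤ 1 := by
  refine (Set.ncard_le_one (Set.toFinite _)).2 fun w hw w' hw' => h.inj hw.1 hw'.1 ?_
  rcases hv with hv | hv
  · rw [hw.2.resolve_left (hv w hw.1), hw'.2.resolve_left (hv w' hw'.1)]
  · rw [hw.2.resolve_right (hv w hw.1), hw'.2.resolve_right (hv w' hw'.1)]

/-- At most two vertices of a Kempe chain miss one of its colours. -/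
theorem IsProperEdge.not_three_ends [Finite V] (h : R.IsProperEdge φ) {x y z : V} (hxy : x ≠ y)
    (hxz : x ≠ z) (hyz : y ≠ z) (hx : R.Misses φ x p ∨ R.Misses φ x q)
    (hy : R.Misses φ y p ∨ R.Misses φ y q) (hz : R.Misses φ z p ∨ R.Misses φ z q)
    (h₁ : (R.kempeGraph φ h.symm p q).Reachable x y)
    (h₂ : (R.kempeGraph φ h.symm p q).Reachable x z) : False :=
  SimpleGraph.not_three_ends (ncard_neighborSet_kempeGraph_le_two h) hxy hxz hyz
    (ncard_neighborSet_kempeGraph_le_one h hx) (ncard_neighborSet_kempeGraph_le_one h hy)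
    (ncard_neighborSet_kempeGraph_le_one h hz) h₁ h₂

end ThreeEnds

/-! ### A finite game abstracting Kempe exchanges at five terminals with four colours. -/

namespace KempeGame

/-- For five terminal vertices and four colours, which colours are known to be missing where. -/
abbrev State := Fin 5 → Fin 4 → Bool

/-- All ways to partition a list into blocks of one or two elements (`n` bounds its length). -/
def pairings {α : Type*} [DecidableEq α] : ℕ → List α → List (List (List α))
  | 0, _ => [[]]
  | _ + 1, [] => [[]]
  | n + 1, t :: l => (pairings n l).map ([t] :: ·) ++
      l.flatMap fun u => (pairings n (l.erase u)).map ([t, u] :: ·)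

/-- Interchange the colours `p` and `q` in the missing sets of the terminals in `X`. -/
def exchange (p q : Fin 4) (X : List (Fin 5)) (s : State) : State :=
  fun t i => if t ∈ X then s t (Equiv.swap p q i) else s t i

/-- The terminals known to miss exactly one of `p` and `q`. -/
def ends (p q : Fin 4) (s : State) : List (Fin 5) :=
  (List.finRange 5).filter fun t => s t p != s t q

/-- Some choice of blocks of `A`, exchanged one after the other, leads to a state with `P`. -/
def anyExchange (p q : Fin 4) : List (List (Fin 5)) → State → (State → Bool) → Bool
  | [], s, P => P s
  | X :: A, s, P => anyExchange p q A s P || anyExchange p q A (exchange p q X s) P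

/-- The permutations of the four colours. -/
def perms : List (Fin 4 → Fin 4) :=
  [![0,1,2,3], ![0,1,3,2], ![0,2,1,3], ![0,2,3,1], ![0,3,1,2], ![0,3,2,1],
   ![1,0,2,3], ![1,0,3,2], ![1,2,0,3], ![1,2,3,0], ![1,3,0,2], ![1,3,2,0],
   ![2,0,1,3], ![2,0,3,1], ![2,1,0,3], ![2,1,3,0], ![2,3,0,1], ![2,3,1,0],
   ![3,0,1,2], ![3,0,2,1], ![3,1,0,2], ![3,1,2,0], ![3,2,0,1], ![3,2,1,0]]

/-- Terminals `0`, `2`, `3`, `4` can be given distinct missing colours so that a further missing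
colour of `0` differs from a missing colour of `1`. -/
def final (s : State) : Bool :=
  perms.any fun σ => s 0 (σ 0) && (s 2 (σ 1) && (s 3 (σ 2) && (s 4 (σ 3) &&
    [σ 1, σ 2, σ 3].any fun e => s 0 e && (List.finRange 4).any fun f => s 1 f && e != f)))

/-- After the renaming `σ` of colours, everything missing in `s'` is missing in `s`. -/
def le (σ : Fin 4 → Fin 4) (s' s : State) : Bool :=
  (List.finRange 5).all fun t => (List.finRange 4).all fun i => !(s' t i) || s t (σ i)

/-- The state is final or contains one of the states in `prev`. -/
def good (prev : List State) (s : State) : Bool :=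
  final s || prev.any fun s' => perms.any fun σ => le σ s' s

/-- However the chains of colours `p`, `q` and those of colours `r`, `u` pair up their ends, some
exchanges along them lead to a good state. -/
def wins (p q r u : Fin 4) (prev : List State) (s : State) : Bool :=
  (pairings 5 (ends p q s)).all fun A => (pairings 5 (ends r u s)).all fun B =>
    anyExchange p q A s fun s' => anyExchange r u B s' (good prev)

/-- The state with the given lists of missing colours. -/
def mk (b c x y z : List (Fin 4)) : State := fun t i => decide (i ∈ (![b, c, x, y, z] t))

/-- Classes within `l` have at most two members, so removing the head together with its only
possible partner reconstructs the partition inside the enumeration. This turns the unknown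
connections between chain ends into finitely many cases. -/
theorem exists_pairing {α : Type*} [DecidableEq α] {rel : α → α → Prop} (hrel : Equivalence rel) :
    ∀ (n : ℕ) (l : List α), l.length ≤ n → l.Nodup →
      (∀ x ∈ l, ∀ y ∈ l, ∀ z ∈ l, x ≠ y → x ≠ z → y ≠ z → rel x y → rel x z → False) →
      ∃ A ∈ pairings n l, ∀ X ∈ A, ∃ r ∈ l, ∀ t, t ∈ X ↔ t ∈ l ∧ rel r t
  | 0, l, hl, _, _ => ⟨[], by simp [pairings], by simp⟩
  | n + 1, [], _, _, _ => ⟨[], by simp [pairings], by simp⟩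
  | n + 1, t :: l, hl, hd, h3 => by
    obtain ⟨htl, hd'⟩ := List.nodup_cons.1 hd
    by_cases hu : ∃ u ∈ l, rel t u
    · obtain ⟨u, hul, htu⟩ := hu
      have hne : t ≠ u := fun e => htl (e ▸ hul)
      have hmem : ∀ w, w ∈ l.erase u ↔ w ≠ u ∧ w ∈ l := fun w => hd'.mem_erase_iff
      have honly : ∀ w ∈ l, rel t w → w = u := by
        intro w hw htw
        by_contra hwu
        exact h3 t (by simp) u (by simp [hul]) w (by simp [hw]) hne
          (fun e => htl (e ▸ hw)) (fun e => hwu e.symm) htu htw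
      obtain ⟨A, hA, hAX⟩ := exists_pairing hrel n (l.erase u)
        ((List.length_erase_le).trans (by simpa using hl)) (hd'.erase u)
        (fun x hx y hy z hz => h3 x (by simp [((hmem x).1 hx).2]) y (by simp [((hmem y).1 hy).2])
          z (by simp [((hmem z).1 hz).2]))
      refine ⟨[t, u] :: A, ?_, ?_⟩
      · simp only [pairings, List.mem_append, List.mem_flatMap]
        exact Or.inr ⟨u, hul, List.mem_map_of_mem hA⟩
      · intro X hX
        rcases List.mem_cons.1 hX with rfl | hX
        · refine ⟨t, by simp, fun w => ?_⟩
          constructor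
          · intro hw
            simp only [List.mem_cons, List.not_mem_nil, or_false] at hw
            rcases hw with rfl | rfl
            · exact ⟨by simp, hrel.refl _⟩
            · exact ⟨by simp [hul], htu⟩
          · rintro ⟨hw, htw⟩
            rcases List.mem_cons.1 hw with rfl | hw
            · simp
            · simp [honly w hw htw]
        · obtain ⟨r, hr, hrX⟩ := hAX X hX
          have hr' := (hmem r).1 hr
          have hnt : ¬ rel t r := fun h => hr'.1 (honly r hr'.2 h)
          refine ⟨r, by simp [hr'.2], fun w => ?_⟩
          rw [hrX, hmem, List.mem_cons]
          constructor
          · rintro ⟨⟨_, hw⟩, h⟩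
            exact ⟨Or.inr hw, h⟩
          · rintro ⟨rfl | hw, h⟩
            · exact absurd (hrel.symm h) hnt
            · refine ⟨⟨?_, hw⟩, h⟩
              rintro rfl
              exact hnt (hrel.trans htu (hrel.symm h))
    · push Not at hu
      obtain ⟨A, hA, hAX⟩ := exists_pairing hrel n l (by simpa using hl) hd'
        (fun x hx y hy z hz => h3 x (by simp [hx]) y (by simp [hy]) z (by simp [hz]))
      refine ⟨[t] :: A, ?_, ?_⟩
      · simp only [pairings, List.mem_append]
        exact Or.inl (List.mem_map_of_mem hA)
      · intro X hX
        rcases List.mem_cons.1 hX with rfl | hX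
        · refine ⟨t, by simp, fun w => ?_⟩
          constructor
          · intro hw
            obtain rfl : w = t := by simpa using hw
            exact ⟨by simp, hrel.refl _⟩
          · rintro ⟨hw, htw⟩
            rcases List.mem_cons.1 hw with rfl | hw
            · simp
            · exact absurd htw (hu w hw)
        · obtain ⟨r, hr, hrX⟩ := hAX X hX
          refine ⟨r, by simp [hr], fun w => ?_⟩
          rw [hrX, List.mem_cons]
          constructor
          · rintro ⟨hw, h⟩
            exact ⟨Or.inr hw, h⟩
          · rintro ⟨rfl | hw, h⟩
            · exact absurd (hrel.symm h) (hu r hr)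
            · exact ⟨hw, h⟩

/-! ### Transfer from the game to actual colourings. -/

section Realizes

variable {V : Type*} {k : ℕ} {R : SimpleGraph V} {φ₀ φ : V → V → Fin k} {v : Fin 5 → V}
  {κ : Fin 4 → Fin k} {s : State}

/-- The colouring `φ` of `R` has at the terminals `v` the missing colours given by `s`, and every
colour outside the range of `κ` is still missing wherever `φ₀` misses it. -/
structure Realizes (R : SimpleGraph V) (φ₀ : V → V → Fin k) (v : Fin 5 → V) (κ : Fin 4 → Fin k)
    (s : State) (φ : V → V → Fin k) : Prop where
  proper : R.IsProperEdge φ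
  misses : ∀ t i, s t i = true → R.Misses φ (v t) (κ i)
  outside : ∀ w j, j ∉ Set.range κ → R.Misses φ₀ w j → R.Misses φ w j

theorem Realizes.kempeSwap (h : Realizes R φ₀ v κ s φ) (hκ : κ.Injective) {p q : Fin 4}
    {X : Set V} (hX : (R.kempeGraph φ h.proper.symm (κ p) (κ q)).IsClosedUnder X) {s' : State}
    (hs : ∀ t i, s' t i = true → (v t ∈ X → s t (Equiv.swap p q i) = true) ∧
      (v t ∉ X → s t i = true)) :
    Realizes R φ₀ v κ s' (SimpleGraph.kempeSwap φ (κ p) (κ q) X) where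
  proper := h.proper.kempeSwap hX
  misses t i hi := by
    by_cases ht : v t ∈ X
    · rw [misses_kempeSwap_of_mem h.proper.symm hX ht, ← hκ.map_swap]
      exact h.misses _ _ ((hs t i hi).1 ht)
    · rw [misses_kempeSwap_of_notMem ht]
      exact h.misses _ _ ((hs t i hi).2 ht)
  outside w j hj hw := by
    rw [misses_kempeSwap_of_ne h.proper.symm hX]
    · exact h.outside w j hj hw
    · rintro rfl; exact hj ⟨p, rfl⟩
    · rintro rfl; exact hj ⟨q, rfl⟩

theorem exchange_apply_of_ne {p q i : Fin 4} (hp : i ≠ p) (hq : i ≠ q) (X : List (Fin 5))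
    (t : Fin 5) : exchange p q X s t i = s t i := by
  simp [exchange, Equiv.swap_apply_of_ne_of_ne hp hq]

theorem apply_swap_of_eq {p q : Fin 4} {t : Fin 5} (h : s t p = s t q) (i : Fin 4) :
    s t (Equiv.swap p q i) = s t i := by
  rcases eq_or_ne i p with rfl | hp
  · rw [Equiv.swap_apply_left, h]
  rcases eq_or_ne i q with rfl | hq
  · rw [Equiv.swap_apply_right, h]
  rw [Equiv.swap_apply_of_ne_of_ne hp hq]

/-- An exchange of p and q permutes the edges of the (p,q)-graph and does not affect the edges of
colours r and u. Both Kempe graphs `K` and `L` therefore stay fixed through the recursion, and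
pairings read off at the start remain valid. Terminals that agree on p and q have the same record
after an exchange, so only the ends matter. -/
theorem exists_of_anyExchange (hκ : κ.Injective) {p q r u : Fin 4} (hrp : r ≠ p) (hrq : r ≠ q)
    (hup : u ≠ p) (huq : u ≠ q) {K L : SimpleGraph V} {P : State → Bool} :
    ∀ (A : List (List (Fin 5))) (s : State) (φ : V → V → Fin k) (h : Realizes R φ₀ v κ s φ),
      R.kempeGraph φ h.proper.symm (κ p) (κ q) = K → R.kempeGraph φ h.proper.symm (κ r) (κ u) = L →
      (∀ X ∈ A, ∃ a, ∀ t, s t p ≠ s t q → (t ∈ X ↔ K.Reachable (v a) (v t))) →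
      anyExchange p q A s P = true →
      ∃ s' φ', ∃ h' : Realizes R φ₀ v κ s' φ', P s' = true ∧
        R.kempeGraph φ' h'.proper.symm (κ r) (κ u) = L ∧
        ∀ t, s' t r = s t r ∧ s' t u = s t u
  | [], s, φ, h, _, hL, _, hP => ⟨s, φ, h, hP, hL, fun _ => ⟨rfl, rfl⟩⟩
  | X :: A, s, φ, h, hK, hL, hA, hP => by
    simp only [anyExchange, Bool.or_eq_true] at hP
    rcases hP with hP | hP
    · exact exists_of_anyExchange hκ hrp hrq hup huq A s φ h hK hL
        (fun Y hY => hA Y (List.mem_cons_of_mem _ hY)) hP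
    · obtain ⟨a, ha⟩ := hA X List.mem_cons_self
      have hcl : (R.kempeGraph φ h.proper.symm (κ p) (κ q)).IsClosedUnder
          {w | K.Reachable (v a) w} := by
        rw [hK]; exact isClosedUnder_reachable K (v a)
      have h' := h.kempeSwap hκ hcl (s' := exchange p q X s) (by
        intro t i hi
        by_cases hend : s t p = s t q
        · have hi' : s t i = true := by
            unfold exchange at hi
            split_ifs at hi
            · rwa [apply_swap_of_eq hend] at hi
            · exact hi
          rw [apply_swap_of_eq hend]
          exact ⟨fun _ => hi', fun _ => hi'⟩
        · unfold exchange at hi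
          refine ⟨fun hm => ?_, fun hm => ?_⟩
          · rwa [if_pos ((ha t hend).2 hm)] at hi
          · rwa [if_neg (fun hx => hm ((ha t hend).1 hx))] at hi)
      have hK' : R.kempeGraph _ h'.proper.symm (κ p) (κ q) = K := by
        refine (kempeGraph_kempeSwap h.proper.symm h'.proper.symm fun i => ?_).trans hK
        rw [Equiv.swap_apply_eq_iff, Equiv.swap_apply_eq_iff, Equiv.swap_apply_left,
          Equiv.swap_apply_right, or_comm]
      have hL' : R.kempeGraph _ h'.proper.symm (κ r) (κ u) = L := by
        refine (kempeGraph_kempeSwap h.proper.symm h'.proper.symm fun i => ?_).trans hL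
        rw [Equiv.swap_apply_eq_iff, Equiv.swap_apply_eq_iff,
          Equiv.swap_apply_of_ne_of_ne (hκ.ne hrp) (hκ.ne hrq),
          Equiv.swap_apply_of_ne_of_ne (hκ.ne hup) (hκ.ne huq)]
      obtain ⟨s', φ', hr, hPs, hLs, he⟩ := exists_of_anyExchange hκ hrp hrq hup huq A _ _ h' hK' hL'
        (by
          intro Y hY
          obtain ⟨b, hb⟩ := hA Y (List.mem_cons_of_mem _ hY)
          refine ⟨b, fun t ht => hb t fun hend => ht ?_⟩
          unfold exchange
          split_ifs
          · rw [apply_swap_of_eq hend, apply_swap_of_eq hend, hend]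
          · exact hend) hP
      refine ⟨s', φ', hr, hPs, hLs, fun t => ?_⟩
      rw [(he t).1, (he t).2, exchange_apply_of_ne hrp hrq, exchange_apply_of_ne hup huq]
      exact ⟨rfl, rfl⟩

theorem exists_pairing_ends [Finite V] (h : Realizes R φ₀ v κ s φ) (hv : v.Injective)
    (p q : Fin 4) : ∃ A ∈ pairings 5 (ends p q s), ∀ X ∈ A, ∃ a, ∀ t, s t p ≠ s t q →
      (t ∈ X ↔ (R.kempeGraph φ h.proper.symm (κ p) (κ q)).Reachable (v a) (v t)) := by
  have hmiss : ∀ t ∈ ends p q s, R.Misses φ (v t) (κ p) ∨ R.Misses φ (v t) (κ q) := by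
    intro t ht
    have ht' : s t p ≠ s t q := by simpa [ends] using ht
    by_cases hp : s t p = true
    · exact Or.inl (h.misses _ _ hp)
    · refine Or.inr (h.misses _ _ ?_)
      revert hp ht'
      cases s t p <;> cases s t q <;> simp
  obtain ⟨A, hA, hAX⟩ := exists_pairing
    (rel := fun a t => (R.kempeGraph φ h.proper.symm (κ p) (κ q)).Reachable (v a) (v t))
    ⟨fun _ => Reachable.refl _, fun h => h.symm, fun h h' => h.trans h'⟩ 5 (ends p q s)
    ((List.length_filter_le _ _).trans (by simp)) ((List.nodup_finRange 5).filter _)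
    (fun x hx y hy z hz hxy hxz hyz h₁ h₂ => h.proper.not_three_ends (hv.ne hxy) (hv.ne hxz)
      (hv.ne hyz) (hmiss x hx) (hmiss y hy) (hmiss z hz) h₁ h₂)
  refine ⟨A, hA, fun X hX => ?_⟩
  obtain ⟨a, -, ha⟩ := hAX X hX
  refine ⟨a, fun t ht => ?_⟩
  rw [ha, and_iff_right]
  simpa [ends] using ht

theorem exists_of_wins [Finite V] (h : Realizes R φ₀ v κ s φ) (hv : v.Injective)
    (hκ : κ.Injective) {p q r u : Fin 4} (hd : r ≠ p ∧ r ≠ q ∧ u ≠ p ∧ u ≠ q) {prev : List State}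
    (hw : wins p q r u prev s = true) :
    ∃ s' φ', Realizes R φ₀ v κ s' φ' ∧ good prev s' = true := by
  obtain ⟨A, hA, hAX⟩ := exists_pairing_ends h hv p q
  obtain ⟨B, hB, hBX⟩ := exists_pairing_ends h hv r u
  have hAB := List.all_eq_true.1 (List.all_eq_true.1 hw A hA) B hB
  obtain ⟨hrp, hrq, hup, huq⟩ := hd
  obtain ⟨s', φ', h', hs', hL, he⟩ :=
    exists_of_anyExchange hκ hrp hrq hup huq A s φ h rfl rfl hAX hAB
  obtain ⟨s'', φ'', h'', hg, -⟩ := exists_of_anyExchange hκ hrp.symm hup.symm hrq.symm huq.symm B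
    s' φ' h' hL rfl (by
      intro X hX
      obtain ⟨a, ha⟩ := hBX X hX
      refine ⟨a, fun t ht => ha t ?_⟩
      rwa [← (he t).1, ← (he t).2]) hs'
  exact ⟨s'', φ'', h'', hg⟩

theorem injective_of_mem_perms : ∀ σ ∈ perms, Function.Injective σ := by decide +kernel

/-- A colouring with the four colours of `J` free to be exchanged has reached a final state. -/
def ReachesFinal (R : SimpleGraph V) (φ₀ : V → V → Fin k) (v : Fin 5 → V) (J : Set (Fin k)) :
    Prop :=
  ∃ κ : Fin 4 → Fin k, κ.Injective ∧ Set.range κ = J ∧ ∃ s φ, Realizes R φ₀ v κ s φ ∧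
    final s = true

/-- Every realization of `s` can be transformed into one of a final state. -/
def IsWinning (R : SimpleGraph V) (φ₀ : V → V → Fin k) (v : Fin 5 → V) (s : State) : Prop :=
  ∀ κ : Fin 4 → Fin k, κ.Injective → ∀ φ, Realizes R φ₀ v κ s φ →
    ReachesFinal R φ₀ v (Set.range κ)

/-- A renaming of colours is absorbed by replacing `κ` with `κ ∘ σ`; the range is unchanged, which
is why `ReachesFinal` depends on the range alone. -/
theorem isWinning_of_wins [Finite V] (hv : v.Injective) {p q r u : Fin 4}
    (hd : r ≠ p ∧ r ≠ q ∧ u ≠ p ∧ u ≠ q) {prev : List State} (hw : wins p q r u prev s = true)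
    (hprev : ∀ s' ∈ prev, IsWinning R φ₀ v s') : IsWinning R φ₀ v s := by
  intro κ hκ φ h
  obtain ⟨s', φ', h', hg⟩ := exists_of_wins h hv hκ hd hw
  simp only [good, Bool.or_eq_true, List.any_eq_true] at hg
  rcases hg with hf | ⟨s'', hs'', σ, hσ, hle⟩
  · exact ⟨κ, hκ, rfl, s', φ', h', hf⟩
  · have hσi := injective_of_mem_perms σ hσ
    have hrange : Set.range (κ ∘ σ) = Set.range κ :=
      (Finite.surjective_of_injective hσi).range_comp κ
    rw [← hrange]
    refine hprev s'' hs'' (κ ∘ σ) (hκ.comp hσi) φ' ⟨h'.proper, fun t i hi => ?_, ?_⟩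
    · refine h'.misses t (σ i) ?_
      simpa [hi] using List.all_eq_true.1 (List.all_eq_true.1 hle t (List.mem_finRange t)) i
        (List.mem_finRange i)
    · rw [hrange]
      exact h'.outside

/-- These are the two patterns that arise in `broom_aux`. Each certificate is one round of exchanges
on two complementary colour pairs, ending in a final state or in a pattern already won; three
auxiliary patterns suffice. -/
theorem isWinning_states [Finite V] (hv : v.Injective) :
    IsWinning R φ₀ v (mk [0, 1] [0] [1, 2] [0, 3] [0]) ∧
      IsWinning R φ₀ v (mk [0, 1] [0] [1, 2] [1, 3] [0]) := by
  have h₁ : IsWinning R φ₀ v (mk [0, 1] [2] [0, 3] [0, 3] [3]) :=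
    isWinning_of_wins hv (p := 0) (q := 1) (r := 2) (u := 3) (prev := []) (by decide)
      (by decide +kernel) (by simp)
  have h₂ : IsWinning R φ₀ v (mk [0, 1] [2] [0, 1] [0, 2] [1]) :=
    isWinning_of_wins hv (p := 0) (q := 2) (r := 1) (u := 3) (prev := []) (by decide)
      (by decide +kernel) (by simp)
  have h₃ : IsWinning R φ₀ v (mk [0, 1] [2] [0, 3] [0, 1] [1]) :=
    isWinning_of_wins hv (p := 0) (q := 2) (r := 1) (u := 3)
      (prev := [mk [0, 1] [2] [0, 3] [0, 3] [3], mk [0, 1] [2] [0, 1] [0, 2] [1]]) (by decide)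
      (by decide +kernel) (by simp [h₁, h₂])
  have h₄ : IsWinning R φ₀ v (mk [0, 1] [0] [1, 2] [0, 3] [0]) :=
    isWinning_of_wins hv (p := 0) (q := 2) (r := 1) (u := 3)
      (prev := [mk [0, 1] [2] [0, 3] [0, 3] [3], mk [0, 1] [2] [0, 1] [0, 2] [1],
        mk [0, 1] [2] [0, 3] [0, 1] [1]]) (by decide)
      (by decide +kernel) (by simp [h₁, h₂, h₃])
  refine ⟨h₄, isWinning_of_wins hv (p := 0) (q := 3) (r := 1) (u := 2)
    (prev := [mk [0, 1] [0] [1, 2] [0, 3] [0], mk [0, 1] [2] [0, 3] [0, 1] [1],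
      mk [0, 1] [2] [0, 1] [0, 2] [1], mk [0, 1] [2] [0, 3] [0, 3] [3]]) (by decide)
    (by decide +kernel) (by simp [h₁, h₂, h₃, h₄])⟩

end Realizes

end KempeGame

/-! ### Critical colourings and the vertices near `a` and `b`. -/

section CriticalColoring

variable {V : Type*} {k : ℕ} {G : SimpleGraph V} {a b : V} {φ : V → V → Fin k}

/-- `φ` is a proper edge colouring of `G - ab` in which each colour is missing at `a` or `b` (and
some colour is missing at each), while `G` itself has no proper edge colouring by these colours. -/
structure IsCriticalColoring (G : SimpleGraph V) (a b : V) (φ : V → V → Fin k) : Prop where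
  adj : G.Adj a b
  not_proper : ∀ ψ : V → V → Fin k, ¬ G.IsProperEdge ψ
  proper : (G.deleteEdges {s(a, b)}).IsProperEdge φ
  cover : ∀ i, (G.deleteEdges {s(a, b)}).Misses φ a i ∨ (G.deleteEdges {s(a, b)}).Misses φ b i
  left : ∃ i, (G.deleteEdges {s(a, b)}).Misses φ a i
  right : ∃ i, (G.deleteEdges {s(a, b)}).Misses φ b i

namespace IsCriticalColoring

theorem swap (h : G.IsCriticalColoring a b φ) : G.IsCriticalColoring b a φ := by
  obtain ⟨h₁, h₂, h₃, h₄, h₅, h₆⟩ := h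
  rw [Sym2.eq_swap] at h₃ h₄ h₅ h₆
  exact ⟨h₁.symm, h₂, h₃, fun i => (h₄ i).symm, h₆, h₅⟩

theorem not_misses_both (h : G.IsCriticalColoring a b φ) {i : Fin k}
    (ha : (G.deleteEdges {s(a, b)}).Misses φ a i)
    (hb : (G.deleteEdges {s(a, b)}).Misses φ b i) : False :=
  h.not_proper _ (h.proper.recolorEdge le_rfl ha hb)

theorem misses_right_of_adj (h : G.IsCriticalColoring a b φ) {v : V}
    (hv : (G.deleteEdges {s(a, b)}).Adj a v) : (G.deleteEdges {s(a, b)}).Misses φ b (φ a v) :=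
  (h.cover _).resolve_left fun h' => h' v hv rfl

theorem misses_left_of_adj (h : G.IsCriticalColoring a b φ) {v : V}
    (hv : (G.deleteEdges {s(a, b)}).Adj b v) : (G.deleteEdges {s(a, b)}).Misses φ a (φ b v) :=
  (h.cover _).resolve_right fun h' => h' v hv rfl

/-- If the chain at `b` avoided `a`, exchanging it would make p missing at both, and `ab` could be
coloured p. -/
theorem reachable (h : G.IsCriticalColoring a b φ) {p q : Fin k}
    (hp : (G.deleteEdges {s(a, b)}).Misses φ a p)
    (hq : (G.deleteEdges {s(a, b)}).Misses φ b q) :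
    ((G.deleteEdges {s(a, b)}).kempeGraph φ h.proper.symm p q).Reachable b a := by
  by_contra hr
  have hcl := isClosedUnder_reachable
    ((G.deleteEdges {s(a, b)}).kempeGraph φ h.proper.symm p q) b
  refine h.not_proper _ ((h.proper.kempeSwap hcl).recolorEdge (x := a) (y := b) (i := p) le_rfl
    ?_ ?_)
  · exact (misses_kempeSwap_of_notMem (X := {w |
      ((G.deleteEdges {s(a, b)}).kempeGraph φ h.proper.symm p q).Reachable b w}) hr p).2 hp
  · rw [misses_kempeSwap_of_mem h.proper.symm hcl (Reachable.refl b), Equiv.swap_apply_left]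
    exact hq

/-- The Kempe chain ending at a third vertex can be interchanged without touching the edges at `a`
and `b`. -/
theorem exists_switch [Finite V] (h : G.IsCriticalColoring a b φ) {p q : Fin k}
    (hp : (G.deleteEdges {s(a, b)}).Misses φ a p)
    (hq : (G.deleteEdges {s(a, b)}).Misses φ b q) {v : V} (hva : v ≠ a) (hvb : v ≠ b)
    (hv : (G.deleteEdges {s(a, b)}).Misses φ v p ∨ (G.deleteEdges {s(a, b)}).Misses φ v q) :
    ∃ φ' : V → V → Fin k, G.IsCriticalColoring a b φ' ∧
      (∀ i, (G.deleteEdges {s(a, b)}).Misses φ v (Equiv.swap p q i) →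
        (G.deleteEdges {s(a, b)}).Misses φ' v i) ∧
      (∀ w, (G.deleteEdges {s(a, b)}).Adj v w → φ' v w = Equiv.swap p q (φ v w)) ∧
      (∀ w, φ' a w = φ a w) ∧ (∀ w, φ' b w = φ b w) ∧
      (∀ w i, i ≠ p → i ≠ q → (G.deleteEdges {s(a, b)}).Misses φ w i →
        (G.deleteEdges {s(a, b)}).Misses φ' w i) ∧
      (∀ w i, (G.deleteEdges {s(a, b)}).Misses φ w i →
        ∃ j, (G.deleteEdges {s(a, b)}).Misses φ' w j) := by
  set H := G.deleteEdges {s(a, b)} with hH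
  have hcl := isClosedUnder_reachable (H.kempeGraph φ h.proper.symm p q) v
  set X := {w | (H.kempeGraph φ h.proper.symm p q).Reachable v w} with hX
  have hab := h.reachable hp hq
  -- Otherwise `a`, `b` and `v` would be three ends of one chain.
  have hb : b ∉ X := fun hb => h.proper.not_three_ends (p := p) (q := q) h.adj.ne' hvb.symm hva.symm
    (Or.inr hq) (Or.inl hp) hv hab hb.symm
  have ha : a ∉ X := fun ha => hb (Reachable.trans ha hab.symm)
  refine ⟨kempeSwap φ p q X, ⟨h.adj, h.not_proper, h.proper.kempeSwap hcl, fun i => ?_, ?_, ?_⟩,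
    fun i hi => ?_, fun w hw => ?_, fun w => ?_, fun w => ?_, fun w i h₁ h₂ h₃ => ?_,
    fun w i hi => ?_⟩
  · rw [misses_kempeSwap_of_notMem ha, misses_kempeSwap_of_notMem hb]
    exact h.cover i
  · exact h.left.imp fun i => (misses_kempeSwap_of_notMem ha i).2
  · exact h.right.imp fun i => (misses_kempeSwap_of_notMem hb i).2
  · exact (misses_kempeSwap_of_mem h.proper.symm hcl (Reachable.refl v) i).2 hi
  · exact kempeSwap_of_mem h.proper.symm hcl hw (Reachable.refl v)
  · exact kempeSwap_of_notMem w ha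
  · exact kempeSwap_of_notMem w hb
  · exact (misses_kempeSwap_of_ne h.proper.symm hcl w h₁ h₂).2 h₃
  · by_cases hw : w ∈ X
    · exact ⟨Equiv.swap p q i, (misses_kempeSwap_of_mem h.proper.symm hcl hw _).2 (by simpa)⟩
    · exact ⟨i, (misses_kempeSwap_of_notMem hw i).2 hi⟩

/-- No colour is missing at a neighbour of `a`. -/
theorem not_misses_of_adj_left [Finite V] (h : G.IsCriticalColoring a b φ) {v : V}
    (hv : (G.deleteEdges {s(a, b)}).Adj a v) (i : Fin k) :
    ¬ (G.deleteEdges {s(a, b)}).Misses φ v i := by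
  have hvb : v ≠ b := by
    rintro rfl
    simp [deleteEdges_adj] at hv
  -- Recolour `av` by d; its old colour, missing at `b`, becomes free at `a` and can be given to
  -- `ab`.
  have base : ∀ {φ : V → V → Fin k}, G.IsCriticalColoring a b φ → ∀ {d : Fin k},
      (G.deleteEdges {s(a, b)}).Misses φ a d →
      ¬ (G.deleteEdges {s(a, b)}).Misses φ v d := by
    intro φ h d ha hvd
    have h₁ := h.proper.recolorEdge (G := G.deleteEdges {s(a, b)}) (x := a) (y := v) (i := d)
      (deleteEdges_le _) ha hvd
    refine h.not_proper _ (h₁.recolorEdge (x := a) (y := b) (i := φ a v) le_rfl ?_ ?_)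
    · intro w hw
      unfold recolorEdge
      split_ifs with hwv
      · exact (ha v hv).symm
      · intro e
        exact hwv (by rw [h.proper.inj hw hv e])
    · intro w hw
      unfold recolorEdge
      rw [if_neg]
      · exact h.misses_right_of_adj hv w hw
      · simp [h.adj.ne', hvb.symm]
  intro hi
  rcases h.cover i with ha | hb
  · exact base h ha hi
  -- A colour missing at both `v` and `b` is first traded at `v` for τ, missing at `a`.
  · obtain ⟨τ, hτ⟩ := h.left
    obtain ⟨φ', h', h₁, -, ha, -⟩ := h.exists_switch hτ hb hv.ne' hvb (Or.inr hi)
    refine base h' (d := τ) (fun w hw => ?_) (h₁ τ (by rwa [Equiv.swap_apply_left]))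
    rw [ha]
    exact hτ w hw

theorem not_misses_of_adj_right [Finite V] (h : G.IsCriticalColoring a b φ) {v : V}
    (hv : (G.deleteEdges {s(a, b)}).Adj b v) (i : Fin k) :
    ¬ (G.deleteEdges {s(a, b)}).Misses φ v i := by
  have := h.swap.not_misses_of_adj_left (v := v) (i := i)
  rw [Sym2.eq_swap] at this
  exact this hv

/-! ### Paths of length two starting at `b`. -/

section Path

variable {u x : V}

/-- Otherwise the colours of `bu` and `ux` could be interchanged; the old colour of `bu`, missing at
`a`, would then be free at `b` for `ab`. -/
theorem not_misses_of_path_aux (h : G.IsCriticalColoring a b φ)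
    (hu : (G.deleteEdges {s(a, b)}).Adj b u) (hx : (G.deleteEdges {s(a, b)}).Adj u x)
    (hxa : x ≠ a) (hxb : x ≠ b) (hb : (G.deleteEdges {s(a, b)}).Misses φ b (φ u x)) :
    ¬ (G.deleteEdges {s(a, b)}).Misses φ x (φ b u) := by
  intro hm
  have hua : u ≠ a := by
    rintro rfl
    simp [deleteEdges_adj, Sym2.eq_swap] at hu
  have hab := h.adj.ne
  have hub := hu.ne
  have hne : φ b u ≠ φ u x := fun e => hb u hu e
  have ha := h.misses_left_of_adj hu
  set H := G.deleteEdges {s(a, b)} with hH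
  have h₁ := (h.proper.mono (deleteEdges_le {s(b, u)})).recolorEdge
    (G := H.deleteEdges {s(b, u)}) (x := u) (y := x) (i := φ b u) (deleteEdges_le _)
    (by
      intro w hw e
      rw [deleteEdges_adj] at hw
      have := h.proper.inj hw.1 hu.symm (e.trans (h.proper.symm b u))
      subst this
      exact hw.2 (by simp [Sym2.eq_swap]))
    (hm.mono (deleteEdges_le _))
  have h₂ := h₁.recolorEdge (G := H) (x := b) (y := u) (i := φ u x) le_rfl
    (by
      intro w hw
      unfold recolorEdge
      rw [if_neg (by simp [hub, hxb.symm])]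
      exact hb w (deleteEdges_le _ hw))
    (by
      intro w hw
      unfold recolorEdge
      split_ifs with hwx
      · exact hne
      · intro e
        exact hwx (by rw [h.proper.inj (deleteEdges_le _ hw) hx e]))
  refine h.not_proper _ (h₂.recolorEdge (x := a) (y := b) (i := φ b u) le_rfl ?_ ?_)
  · intro w hw
    unfold recolorEdge
    rw [if_neg (by simp [hab, hua.symm]), if_neg (by simp [hua.symm, hxa.symm])]
    exact ha w hw
  · intro w hw
    unfold recolorEdge
    rw [if_neg (c := s(b, w) = s(u, x)) (by simp [hub, hxb.symm])]
    split_ifs with hwu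
    · exact hne.symm
    · intro e
      exact hwu (by rw [h.proper.inj hw hu e])

variable [Finite V]

/-- Exchanges at `x` turn its missing colour into that of `bu` while keeping the colour of `ux`,
which reduces to `not_misses_of_path_aux`. -/
theorem not_misses_of_path_of_misses_right (h : G.IsCriticalColoring a b φ)
    (hu : (G.deleteEdges {s(a, b)}).Adj b u) (hx : (G.deleteEdges {s(a, b)}).Adj u x)
    (hxa : x ≠ a) (hxb : x ≠ b)
    (hB : ∀ i, ∃ j, j ≠ i ∧ (G.deleteEdges {s(a, b)}).Misses φ b j)
    (hb : (G.deleteEdges {s(a, b)}).Misses φ b (φ u x)) (i : Fin k) :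
    ¬ (G.deleteEdges {s(a, b)}).Misses φ x i := by
  have key : ∀ {φ : V → V → Fin k}, G.IsCriticalColoring a b φ →
      (G.deleteEdges {s(a, b)}).Misses φ b (φ u x) → ∀ {d : Fin k},
      (G.deleteEdges {s(a, b)}).Misses φ b d →
      ¬ (G.deleteEdges {s(a, b)}).Misses φ x d := by
    intro φ h hb d hd hxd
    obtain ⟨φ', h', h₁, h₂, -, h₃, -⟩ :=
      h.exists_switch (h.misses_left_of_adj hu) hd hxa hxb (Or.inr hxd)
    have e : φ' u x = φ u x := by
      rw [h'.proper.symm, h₂ u hx.symm, h.proper.symm x u, Equiv.swap_apply_of_ne_of_ne]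
      · exact (hb u hu).symm
      · rw [h.proper.symm]
        exact hxd u hx.symm
    refine h'.not_misses_of_path_aux hu hx hxa hxb ?_ ?_
    · intro w hw
      rw [e, h₃]
      exact hb w hw
    · rw [h₃]
      exact h₁ _ (by rwa [Equiv.swap_apply_left])
  intro hi
  rcases h.cover i with hai | hbi
  · by_cases hiu : i = φ b u
    · exact h.not_misses_of_path_aux hu hx hxa hxb hb (hiu ▸ hi)
    -- The second colour missing at `b` is needed here: j must differ from the colour of `ux`, or
    -- the exchange would change that edge.
    · obtain ⟨j, hj, hbj⟩ := hB (φ u x)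
      obtain ⟨φ', h', h₁, h₂, -, h₃, -⟩ := h.exists_switch hai hbj hxa hxb (Or.inl hi)
      have e : φ' u x = φ u x := by
        rw [h'.proper.symm, h₂ u hx.symm, h.proper.symm x u, Equiv.swap_apply_of_ne_of_ne]
        · rw [h.proper.symm]
          exact hi u hx.symm
        · exact hj.symm
      refine key h' (d := j) ?_ ?_ (h₁ j (by rwa [Equiv.swap_apply_right]))
      · intro w hw
        rw [e, h₃]
        exact hb w hw
      · intro w hw
        rw [h₃]
        exact hbj w hw
  · exact key h hb hbi hi

/-- If `b` misses at least two colours, then no colour is missing at the end `x` of a path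
`b, u, x`. -/
theorem not_misses_of_path (h : G.IsCriticalColoring a b φ)
    (hu : (G.deleteEdges {s(a, b)}).Adj b u) (hx : (G.deleteEdges {s(a, b)}).Adj u x)
    (hxa : x ≠ a) (hxb : x ≠ b)
    (hB : ∀ i, ∃ j, j ≠ i ∧ (G.deleteEdges {s(a, b)}).Misses φ b j) (i : Fin k) :
    ¬ (G.deleteEdges {s(a, b)}).Misses φ x i := by
  -- If the colour of `ux` is missing at `a`, exchanging it with d along the chain at `x` gives `ux`
  -- the colour d, missing at `b`.
  have key : ∀ {φ : V → V → Fin k}, G.IsCriticalColoring a b φ →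
      (∀ i, ∃ j, j ≠ i ∧ (G.deleteEdges {s(a, b)}).Misses φ b j) →
      (G.deleteEdges {s(a, b)}).Misses φ a (φ u x) → ∀ {d : Fin k},
      (G.deleteEdges {s(a, b)}).Misses φ b d →
      ¬ (G.deleteEdges {s(a, b)}).Misses φ x d := by
    intro φ h hB ha d hd hxd
    obtain ⟨φ', h', h₁, h₂, -, h₃, -⟩ := h.exists_switch ha hd hxa hxb (Or.inr hxd)
    refine h'.not_misses_of_path_of_misses_right hu hx hxa hxb ?_ ?_ (φ u x)
      (h₁ _ (by rwa [Equiv.swap_apply_left]))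
    · intro i
      obtain ⟨j, hj, hbj⟩ := hB i
      exact ⟨j, hj, fun w hw => by rw [h₃]; exact hbj w hw⟩
    · rw [h'.proper.symm, h₂ u hx.symm, h.proper.symm x u, Equiv.swap_apply_left]
      intro w hw
      rw [h₃]
      exact hd w hw
  intro hi
  rcases h.cover (φ u x) with ha | hb
  · rcases h.cover i with hai | hbi
    · obtain ⟨j, hj⟩ := h.right
      obtain ⟨φ', h', h₁, h₂, h₄, h₃, -⟩ := h.exists_switch hai hj hxa hxb (Or.inl hi)
      have e : φ' u x = φ u x := by
        rw [h'.proper.symm, h₂ u hx.symm, h.proper.symm x u, Equiv.swap_apply_of_ne_of_ne]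
        · rw [h.proper.symm]
          exact hi u hx.symm
        · intro e
          exact h.not_misses_both ha (e ▸ hj)
      refine key h' ?_ ?_ (d := j) ?_ (h₁ j (by rwa [Equiv.swap_apply_right]))
      · intro i
        obtain ⟨j, hj, hbj⟩ := hB i
        exact ⟨j, hj, fun w hw => by rw [h₃]; exact hbj w hw⟩
      · intro w hw
        rw [e, h₄]
        exact ha w hw
      · intro w hw
        rw [h₃]
        exact hj w hw
    · exact key h hB ha hbi hi
  · exact h.not_misses_of_path_of_misses_right hu hx hxa hxb hB hb i hi

end Path

end IsCriticalColoring

end CriticalColoring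

/-! ### Brooms `b, u, {x, y}` when `a` has degree two. -/

section Broom

variable {V : Type*} {k : ℕ} {G : SimpleGraph V} {a b c u x y z : V} {φ : V → V → Fin k}

theorem KempeGame.exists_of_final {s : KempeGame.State} (h : KempeGame.final s = true) :
    ∃ σ : Fin 4 → Fin 4, σ.Injective ∧ s 0 (σ 0) = true ∧ s 2 (σ 1) = true ∧ s 3 (σ 2) = true ∧
      s 4 (σ 3) = true ∧ ∃ e f, e ≠ σ 0 ∧ s 0 e = true ∧ s 1 f = true ∧ e ≠ f := by
  simp only [KempeGame.final, List.any_eq_true, Bool.and_eq_true] at h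
  obtain ⟨σ, hσ, h0, h2, h3, h4, e, he, he0, f, -, hf, hef⟩ := h
  have hi := KempeGame.injective_of_mem_perms σ hσ
  refine ⟨σ, hi, h0, h2, h3, h4, e, f, ?_, he0, hf, by simpa using hef⟩
  simp only [List.mem_cons, List.not_mem_nil, or_false] at he
  rcases he with rfl | rfl | rfl <;> exact hi.ne (by decide)

open Classical in
/-- Extend a final colouring of `G - a - u` to `G`. -/
theorem exists_isProperEdge_of_reachesFinal
    (hφ : (G.isolate a).IsProperEdge φ)
    (hN : ∀ w, G.Adj a w → w = b ∨ w = c) (hua : u ≠ a) (hub : u ≠ b) (huc : u ≠ c)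
    (hv : Function.Injective ![b, c, x, y, z]) {J : Set (Fin k)}
    (hJ : ∀ w, (G.isolate a).Adj u w → φ u w ∈ J → w = b ∨ w = x ∨ w = y ∨ w = z)
    (hcu : (G.isolate a).Adj u c → φ u c ∉ J)
    (hfin : KempeGame.ReachesFinal ((G.isolate a).isolate u) φ ![b, c, x, y, z] J) :
    ∃ ψ : V → V → Fin k, G.IsProperEdge ψ := by
  obtain ⟨κ, hκ, rfl, s, φ', hs, hf⟩ := hfin
  obtain ⟨σ, hσ, h0, h2, h3, h4, e, f, he, hse, hsf, hef⟩ := KempeGame.exists_of_final hf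
  have hbc : b ≠ c := hv.ne (a₁ := 0) (a₂ := 1) (by decide)
  have hbx : b ≠ x := hv.ne (a₁ := 0) (a₂ := 2) (by decide)
  have hby : b ≠ y := hv.ne (a₁ := 0) (a₂ := 3) (by decide)
  have hbz : b ≠ z := hv.ne (a₁ := 0) (a₂ := 4) (by decide)
  have hcx : c ≠ x := hv.ne (a₁ := 1) (a₂ := 2) (by decide)
  have hcy : c ≠ y := hv.ne (a₁ := 1) (a₂ := 3) (by decide)
  have hcz : c ≠ z := hv.ne (a₁ := 1) (a₂ := 4) (by decide)
  have hxy : x ≠ y := hv.ne (a₁ := 2) (a₂ := 3) (by decide)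
  have hxz : x ≠ z := hv.ne (a₁ := 2) (a₂ := 4) (by decide)
  have hyz : y ≠ z := hv.ne (a₁ := 3) (a₂ := 4) (by decide)
  have mb : ((G.isolate a).isolate u).Misses φ' b (κ (σ 0)) := hs.misses 0 _ h0
  have mx : ((G.isolate a).isolate u).Misses φ' x (κ (σ 1)) := hs.misses 2 _ h2
  have my : ((G.isolate a).isolate u).Misses φ' y (κ (σ 2)) := hs.misses 3 _ h3
  have mz : ((G.isolate a).isolate u).Misses φ' z (κ (σ 3)) := hs.misses 4 _ h4
  have mb' : ((G.isolate a).isolate u).Misses φ' b (κ e) := hs.misses 0 _ hse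
  have mc' : ((G.isolate a).isolate u).Misses φ' c (κ f) := hs.misses 1 _ hsf
  have hκσ := hκ.comp hσ
  -- New colours on the star at `u`: the four edges that used the exchanged colours go to the
  -- terminals' chosen colours, and all other edges keep theirs.
  set g : V → Fin k := fun w => if w = b then κ (σ 0) else if w = x then κ (σ 1) else
    if w = y then κ (σ 2) else if w = z then κ (σ 3) else φ u w with hg
  have gb : g b = κ (σ 0) := by simp [hg]
  have gx : g x = κ (σ 1) := by simp [hg, hbx.symm]
  have gy : g y = κ (σ 2) := by simp [hg, hby.symm, hxy.symm]
  have gz : g z = κ (σ 3) := by simp [hg, hbz.symm, hxz.symm, hyz.symm]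
  have go : ∀ w, (G.isolate a).Adj u w → (w = b ∨ w = x ∨ w = y ∨ w = z) ∨
      (g w = φ u w ∧ φ u w ∉ Set.range κ) := by
    intro w hw
    by_cases hm : φ u w ∈ Set.range κ
    · exact Or.inl (hJ w hw hm)
    · by_cases h : w = b ∨ w = x ∨ w = y ∨ w = z
      · exact Or.inl h
      · push Not at h
        exact Or.inr ⟨by simp [hg, h], hm⟩
  have gr : ∀ w, w = b ∨ w = x ∨ w = y ∨ w = z → g w ∈ Set.range κ := by
    rintro w (rfl | rfl | rfl | rfl)
    exacts [gb ▸ ⟨_, rfl⟩, gx ▸ ⟨_, rfl⟩, gy ▸ ⟨_, rfl⟩, gz ▸ ⟨_, rfl⟩]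
  have hstar : (G.isolate a).IsProperEdge (recolorStar φ' u g) := by
    refine hs.proper.recolorStar ?_ ?_
    · intro w w' hw hw' hgw
      rcases go w hw with h | ⟨h, hn⟩ <;> rcases go w' hw' with h' | ⟨h', hn'⟩
      · have hinj : ∀ i j, κ (σ i) = κ (σ j) → i = j := fun i j h => hκσ h
        rcases h with rfl | rfl | rfl | rfl <;> rcases h' with rfl | rfl | rfl | rfl <;>
          first
          | rfl
          | (simp only [gb, gx, gy, gz] at hgw
             exact absurd (hinj _ _ hgw) (by decide))
      · exact absurd (hgw ▸ gr w h) (h' ▸ hn')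
      · exact absurd (hgw ▸ gr w' h') (h ▸ hn)
      · exact hφ.inj hw hw' (by rw [← h, ← h', hgw])
    · intro w hw
      rcases go w hw with (rfl | rfl | rfl | rfl) | ⟨h, hn⟩
      · rwa [gb]
      · rwa [gx]
      · rwa [gy]
      · rwa [gz]
      · rw [h]
        -- Without the edge `uw`, its colour is missing at `w`; lying outside the exchanged colours,
        -- it has stayed missing.
        refine hs.outside w _ hn fun w' hw' e' => hw'.2.2 ?_
        exact hφ.inj hw'.1 hw.symm (e'.trans (hφ.symm u w))
  -- The spare colour e at `b` goes to `ab`, and f at `c` goes to `ac`.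
  refine ⟨_, hstar.recolorStar (g := fun w => if w = b then κ e else κ f) ?_ ?_⟩
  · intro w w' hw hw' hgw
    rcases hN w hw with rfl | rfl <;> rcases hN w' hw' with rfl | rfl
    · rfl
    · simp only [if_true, hbc.symm, if_false] at hgw
      exact absurd (hκ hgw) hef
    · simp only [if_true, hbc.symm, if_false] at hgw
      exact absurd (hκ hgw).symm hef
    · rfl
  · intro w hw w' hw'
    unfold recolorStar
    rcases hN w hw with rfl | rfl
    · rw [if_neg hub.symm, if_pos rfl]
      split_ifs with h
      · rw [gb]
        exact (hκ.ne he).symm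
      · exact mb' w' ⟨hw', hub.symm, h⟩
    · rw [if_neg huc.symm, if_neg hbc.symm]
      split_ifs with h
      · subst h
        have hgc : g w = φ w' w := by simp [hg, hbc.symm, hcx, hcy, hcz]
        rw [hgc]
        intro e'
        exact hcu hw'.symm (e' ▸ ⟨f, rfl⟩)
      · exact mc' w' ⟨hw', huc.symm, h⟩

namespace IsCriticalColoring

/-- With the stars at `a` and `u` removed, the colours of `ac`, `bu`, `ux`, `uy` play the roles 0,
1, 2, 3. The missing colours at `b, c, x, y, z` then contain one of the two winning patterns, the
alternative in `my` deciding which. -/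
theorem broom_aux [Finite V] (h : G.IsCriticalColoring a b φ)
    (hN : ∀ w, (G.deleteEdges {s(a, b)}).Adj a w ↔ w = c)
    (hu : (G.deleteEdges {s(a, b)}).Adj b u) (huc : u ≠ c)
    (hx : (G.deleteEdges {s(a, b)}).Adj u x) (hy : (G.deleteEdges {s(a, b)}).Adj u y)
    (hxy : x ≠ y) (hxa : x ≠ a) (hxb : x ≠ b) (hxc : x ≠ c) (hya : y ≠ a) (hyb : y ≠ b)
    (hyc : y ≠ c) (mx : (G.deleteEdges {s(a, b)}).Misses φ x (φ b u))
    (my : (G.deleteEdges {s(a, b)}).Misses φ y (φ b u) ∨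
      (G.deleteEdges {s(a, b)}).Misses φ y (φ a c)) : False := by
  have hac : (G.deleteEdges {s(a, b)}).Adj a c := (hN c).2 rfl
  have mb := h.misses_right_of_adj hac
  have hua : u ≠ a := by
    rintro rfl
    simp [deleteEdges_adj, Sym2.eq_swap] at hu
  have hbc : b ≠ c := by
    rintro rfl
    simp [deleteEdges_adj] at hac
  have hαm : φ b u ≠ φ a c := mb u hu
  have hux : φ u x ≠ φ a c := fun e =>
    h.not_misses_of_path_aux hu hx hxa hxb (e ▸ mb) mx
  have huy : φ u y ≠ φ a c := by
    intro e
    rcases my with my | my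
    · exact h.not_misses_of_path_aux hu hy hya hyb (e ▸ mb) my
    · exact my u hy.symm (by rw [h.proper.symm, e])
  -- As a neighbour of `b`, `u` misses nothing, so it has an edge `uz` of the colour of `ac`.
  have hnu := h.not_misses_of_adj_right hu (φ a c)
  obtain ⟨z, hz, huz⟩ := exists_of_not_misses hnu
  have hαx : φ b u ≠ φ u x := fun e =>
    hxb (h.proper.inj hx hu.symm (by rw [h.proper.symm u b, e]))
  have hαy : φ b u ≠ φ u y := fun e =>
    hyb (h.proper.inj hy hu.symm (by rw [h.proper.symm u b, e]))
  have hxy' : φ u x ≠ φ u y := fun e => hxy (h.proper.inj hx hy e)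
  have hbz : b ≠ z := by
    rintro rfl
    exact hαm (by rw [h.proper.symm, huz])
  have hxz : x ≠ z := by rintro rfl; exact hux huz
  have hyz : y ≠ z := by rintro rfl; exact huy huz
  have hcz : c ≠ z := by
    rintro rfl
    refine hua (h.proper.inj hz.symm hac.symm ?_)
    rw [h.proper.symm c u, huz, h.proper.symm]
  set H := G.deleteEdges {s(a, b)} with hH
  have hle : G.isolate a ≤ H := fun v w hvw => by
    rw [hH, deleteEdges_adj]
    refine ⟨hvw.1, ?_⟩
    simp [hvw.2.1, hvw.2.2]
  have hφ := h.proper.mono hle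
  set R := (G.isolate a).isolate u with hR
  have hRle : R ≤ H := (isolate_le _ _).trans hle
  have hmu : ∀ w, H.Adj u w → R.Misses φ w (φ u w) := by
    intro w hw w' hw' e
    exact hw'.2.2 (h.proper.inj (hRle hw') hw.symm (e.trans (h.proper.symm u w)))
  have hmc : R.Misses φ c (φ a c) := by
    intro w hw e
    exact hw.1.2.2 (h.proper.inj (hRle hw) hac.symm (e.trans (h.proper.symm a c)))
  have hκ : Function.Injective ![φ a c, φ b u, φ u x, φ u y] := by
    intro i j hij
    fin_cases i <;> fin_cases j <;> simp_all [eq_comm]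
  have hv : Function.Injective ![b, c, x, y, z] := by
    intro i j hij
    fin_cases i <;> fin_cases j <;> simp_all [eq_comm]
  have hwin := KempeGame.isWinning_states (R := R) (φ₀ := φ) hv
  have hfin : KempeGame.ReachesFinal R φ ![b, c, x, y, z]
      (Set.range ![φ a c, φ b u, φ u x, φ u y]) := by
    have hb0 := mb.mono hRle
    have hb1 : R.Misses φ b (φ b u) := by
      have := hmu b hu.symm
      rwa [h.proper.symm] at this
    have hx1 := mx.mono hRle
    have hx2 := hmu x hx
    have hy3 := hmu y hy
    have hz0 : R.Misses φ z (φ a c) := huz ▸ hmu z hz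
    rcases my with my | my
    · have hy1 := my.mono hRle
      refine hwin.2 _ hκ φ ⟨hφ.mono (isolate_le _ _), ?_, fun _ _ _ h => h⟩
      intro t i
      fin_cases t <;> fin_cases i <;> simp [KempeGame.mk] <;> assumption
    · have hy0 := my.mono hRle
      refine hwin.1 _ hκ φ ⟨hφ.mono (isolate_le _ _), ?_, fun _ _ _ h => h⟩
      intro t i
      fin_cases t <;> fin_cases i <;> simp [KempeGame.mk] <;> assumption
  obtain ⟨ψ, hψ⟩ := exists_isProperEdge_of_reachesFinal hφ (b := b) (c := c) (u := u)
    (fun w hw => by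
      by_cases hwb : w = b
      · exact Or.inl hwb
      · refine Or.inr ((hN w).1 ?_)
        rw [deleteEdges_adj]
        exact ⟨hw, by simp [hwb, h.adj.ne]⟩)
    hua hu.ne' huc hv (J := Set.range ![φ a c, φ b u, φ u x, φ u y])
    (fun w hw hm => by
      have hw' := hle hw
      obtain ⟨i, hi⟩ := hm
      fin_cases i
      · exact Or.inr (Or.inr (Or.inr (h.proper.inj hw' hz (by rw [huz]; exact hi.symm))))
      · exact Or.inl (h.proper.inj hw' hu.symm (by rw [h.proper.symm u b]; exact hi.symm))
      · exact Or.inr (Or.inl (h.proper.inj hw' hx hi.symm))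
      · exact Or.inr (Or.inr (Or.inl (h.proper.inj hw' hy hi.symm))))
    (fun hw hm => by
      have hw' := hle hw
      obtain ⟨i, hi⟩ := hm
      fin_cases i
      · exact hcz (h.proper.inj hw' hz (by rw [huz]; exact hi.symm))
      · exact hbc.symm (h.proper.inj hw' hu.symm (by rw [h.proper.symm u b]; exact hi.symm))
      · exact hxc.symm (h.proper.inj hw' hx hi.symm)
      · exact hyc.symm (h.proper.inj hw' hy hi.symm))
    hfin
  exact h.not_proper ψ hψ

/-- If `a` has degree two in `G`, then among the ends of a broom with handle `b, u` at most one has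
a missing colour. -/
theorem broom [Finite V] (h : G.IsCriticalColoring a b φ)
    (hN : ∀ w, (G.deleteEdges {s(a, b)}).Adj a w ↔ w = c)
    (hu : (G.deleteEdges {s(a, b)}).Adj b u) (huc : u ≠ c)
    (hx : (G.deleteEdges {s(a, b)}).Adj u x) (hy : (G.deleteEdges {s(a, b)}).Adj u y)
    (hxy : x ≠ y) (hxa : x ≠ a) (hxb : x ≠ b) (hxc : x ≠ c) (hya : y ≠ a) (hyb : y ≠ b)
    (hyc : y ≠ c) {i j : Fin k} (mx : (G.deleteEdges {s(a, b)}).Misses φ x i)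
    (my : (G.deleteEdges {s(a, b)}).Misses φ y j) : False := by
  have hac : (G.deleteEdges {s(a, b)}).Adj a c := (hN c).2 rfl
  have hma : ∀ {φ : V → V → Fin k} (i : Fin k), i ≠ φ a c →
      (G.deleteEdges {s(a, b)}).Misses φ a i := by
    intro φ i hi w hw
    rw [(hN w).1 hw]
    exact hi.symm
  -- Any other colour missing at `y` can be traded for that of `ac`; the colour of `bu` is not
  -- involved, so `x` keeps missing it.
  have second : ∀ {φ : V → V → Fin k}, G.IsCriticalColoring a b φ →
      (G.deleteEdges {s(a, b)}).Misses φ x (φ b u) → ∀ {j : Fin k},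
      (G.deleteEdges {s(a, b)}).Misses φ y j → False := by
    intro φ h mx j my
    by_cases hj : j = φ b u ∨ j = φ a c
    · refine h.broom_aux hN hu huc hx hy hxy hxa hxb hxc hya hyb hyc mx ?_
      rcases hj with rfl | rfl
      exacts [Or.inl my, Or.inr my]
    · push Not at hj
      have mb := h.misses_right_of_adj hac
      obtain ⟨φ', h', h₁, -, h₂, h₃, h₄, -⟩ :=
        h.exists_switch (hma j hj.2) mb hya hyb (Or.inl my)
      refine h'.broom_aux hN hu huc hx hy hxy hxa hxb hxc hya hyb hyc ?_ (Or.inr ?_)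
      · rw [h₃]
        exact h₄ x _ hj.1.symm (mb u hu) mx
      · rw [h₂]
        exact h₁ _ (by rwa [Equiv.swap_apply_right])
  -- Here the exchange at `x` may alter what `y` misses, but `y` still misses something.
  have first : ∀ {φ : V → V → Fin k}, G.IsCriticalColoring a b φ →
      (G.deleteEdges {s(a, b)}).Misses φ x (φ a c) → ∀ {j : Fin k},
      (G.deleteEdges {s(a, b)}).Misses φ y j → False := by
    intro φ h mx j my
    obtain ⟨φ', h', h₁, -, -, h₃, -, h₅⟩ :=
      h.exists_switch (h.misses_left_of_adj hu) (h.misses_right_of_adj hac) hxa hxb (Or.inr mx)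
    obtain ⟨j', hj'⟩ := h₅ y j my
    refine second h' ?_ hj'
    rw [h₃]
    exact h₁ _ (by rwa [Equiv.swap_apply_left])
  by_cases hi : i = φ a c
  · exact first h (hi ▸ mx) my
  · obtain ⟨φ', h', h₁, -, h₂, -, -, h₅⟩ :=
      h.exists_switch (hma i hi) (h.misses_right_of_adj hac) hxa hxb (Or.inl mx)
    obtain ⟨j', hj'⟩ := h₅ y j my
    refine first h' ?_ hj'
    rw [h₂]
    exact h₁ _ (by rwa [Equiv.swap_apply_right])

end IsCriticalColoring

end Broom

/-! ### Degree counts, and the colouring supplied by a full-deficiency pair. -/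

section FullDeficiency

variable {V : Type*}

theorem IsProperEdge.ncard_misses_add {k : ℕ} {R : SimpleGraph V} {φ : V → V → Fin k}
    (h : R.IsProperEdge φ) (v : V) :
    {i | R.Misses φ v i}.ncard + (R.neighborSet v).ncard = k := by
  have himg : {i | R.Misses φ v i} = (φ v '' R.neighborSet v)ᶜ := by
    ext i
    simp [Misses]
  have hinj : Set.InjOn (φ v) (R.neighborSet v) := fun w hw w' hw' e => h.inj hw hw' e
  rw [himg, ← hinj.ncard_image, add_comm, Set.ncard_add_ncard_compl]
  simp

theorem deleteEdges_adj_of_ne {G : SimpleGraph V} {a b x y : V} (h : G.Adj x y) (hxa : x ≠ a) (hxb : x ≠ b) :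
    (G.deleteEdges {s(a, b)}).Adj x y := by
  rw [deleteEdges_adj]
  exact ⟨h, by simp [hxa, hxb]⟩

variable [Fintype V]

theorem ncard_neighborSet_eq_degree (G : SimpleGraph V) [DecidableRel G.Adj] (v : V) :
    (G.neighborSet v).ncard = G.degree v := by
  rw [← card_neighborSet_eq_degree, ← Nat.card_coe_set_eq, Nat.card_eq_fintype_card]

theorem ncard_neighborSet_deleteEdges_add_one {G : SimpleGraph V} [DecidableRel G.Adj] {a b : V}
    (h : G.Adj a b) : ((G.deleteEdges {s(a, b)}).neighborSet a).ncard + 1 = G.degree a := by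
  have he : (G.deleteEdges {s(a, b)}).neighborSet a = G.neighborSet a \ {b} := by
    ext w
    simp only [mem_neighborSet, deleteEdges_adj, Set.mem_sdiff, Set.mem_singleton_iff]
    simp [h.ne]
  rw [he, Set.ncard_sdiff_singleton_add_one (show b ∈ G.neighborSet a from h),
    ncard_neighborSet_eq_degree]

theorem maxDegree_le_of_isProperEdge {k : ℕ} {G : SimpleGraph V} [DecidableRel G.Adj]
    {φ : V → V → Fin k} (h : G.IsProperEdge φ) : G.maxDegree ≤ k := by
  refine G.maxDegree_le_of_forall_degree_le k fun v => ?_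
  rw [← ncard_neighborSet_eq_degree]
  exact (Nat.le_add_left _ _).trans (h.ncard_misses_add v).le

/-- Colour `G - ab` with k = χ'(G) - 1 colours; class 2 gives k ≥ Δ. The disjoint missing sets at
`a` and `b` have total size 2k - Δ ≤ k, so k = Δ and they cover all colours. Vizing's theorem is not
needed. -/
theorem exists_isCriticalColoring {G : SimpleGraph V} [DecidableRel G.Adj] {a b : V}
    (hG : G.IsClassTwo) (hab : G.IsFullDeficiencyPair a b) (hcrit : G.IsCriticalEdge s(a, b)) :
    ∃ φ : V → V → Fin G.maxDegree, G.IsCriticalColoring a b φ := by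
  obtain ⟨hadj, hsum⟩ := hab
  have hlt := hcrit.2
  set H := G.deleteEdges {s(a, b)} with hH
  obtain ⟨CG⟩ : Nonempty (G.EdgeColoring G.chromaticIndex) := Nat.sInf_mem G.exists_edgeColoring
  have hH' : H.lineGraph.Colorable H.chromaticIndex := Nat.sInf_mem H.exists_edgeColoring
  obtain ⟨k, hk⟩ : ∃ k, G.chromaticIndex = k + 1 := Nat.exists_eq_succ_of_ne_zero (by omega)
  have hΔ : G.maxDegree < G.chromaticIndex := by
    have : NeZero G.chromaticIndex := ⟨by omega⟩
    obtain ⟨ψ, hψ⟩ := exists_isProperEdge_of_edgeColoring CG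
    exact lt_of_le_of_ne (maxDegree_le_of_isProperEdge hψ) (Ne.symm hG)
  have hda : 0 < G.degree a := (G.degree_pos_iff_exists_adj a).2 ⟨b, hadj⟩
  have hdaΔ := G.degree_le_maxDegree a
  have hdbΔ := G.degree_le_maxDegree b
  have : NeZero k := ⟨by omega⟩
  obtain ⟨CH⟩ : H.lineGraph.Colorable k := hH'.mono (by omega)
  obtain ⟨φ, hφ⟩ := exists_isProperEdge_of_edgeColoring CH
  have hnot : ∀ ψ : V → V → Fin k, ¬ G.IsProperEdge ψ := fun ψ hψ =>
    Nat.notMem_of_lt_sInf (show k < G.chromaticIndex by omega)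
      (nonempty_edgeColoring_of_isProperEdge hψ)
  have ha := hφ.ncard_misses_add a
  have hb := hφ.ncard_misses_add b
  have ha' := ncard_neighborSet_deleteEdges_add_one hadj
  have hb' := ncard_neighborSet_deleteEdges_add_one hadj.symm
  rw [Sym2.eq_swap] at hb'
  rw [← hH] at ha' hb'
  have hdisj : Disjoint {i | H.Misses φ a i} {i | H.Misses φ b i} :=
    Set.disjoint_left.2 fun i hi hi' => hnot _ (hφ.recolorEdge le_rfl hi hi')
  have hunion := Set.ncard_union_eq hdisj
  have hle : ({i | H.Misses φ a i} ∪ {i | H.Misses φ b i}).ncard ≤ k := by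
    simpa using Set.ncard_le_card ({i | H.Misses φ a i} ∪ {i | H.Misses φ b i})
  obtain rfl : k = G.maxDegree := by omega
  have huniv : {i | H.Misses φ a i} ∪ {i | H.Misses φ b i} = Set.univ := by
    refine Set.eq_of_subset_of_ncard_le (Set.subset_univ _) ?_
    rw [Set.ncard_univ, Nat.card_eq_fintype_card, Fintype.card_fin]
    omega
  refine ⟨φ, hadj, hnot, hφ, fun i => ?_, ?_, ?_⟩
  · have : i ∈ {i | H.Misses φ a i} ∪ {i | H.Misses φ b i} := huniv ▸ Set.mem_univ i
    exact this
  · exact Set.nonempty_of_ncard_ne_zero (s := {i | H.Misses φ a i}) (by omega)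
  · exact Set.nonempty_of_ncard_ne_zero (s := {i | H.Misses φ b i}) (by omega)

namespace IsCriticalColoring

variable {G : SimpleGraph V} [DecidableRel G.Adj] {a b : V} {φ : V → V → Fin G.maxDegree}

theorem exists_misses (h : G.IsCriticalColoring a b φ) {x : V} (hx : G.degree x < G.maxDegree) :
    ∃ i, (G.deleteEdges {s(a, b)}).Misses φ x i := by
  have h₁ := h.proper.ncard_misses_add x
  have h₂ : ((G.deleteEdges {s(a, b)}).neighborSet x).ncard ≤ (G.neighborSet x).ncard :=
    Set.ncard_le_ncard fun w hw => deleteEdges_le {s(a, b)} hw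
  rw [G.ncard_neighborSet_eq_degree] at h₂
  exact Set.nonempty_of_ncard_ne_zero (s := {i | (G.deleteEdges {s(a, b)}).Misses φ x i})
    (by omega)

theorem not_adj_of_degree_lt (h : G.IsCriticalColoring a b φ) {x : V}
    (hx : G.degree x < G.maxDegree) (hxa : x ≠ a) (hxb : x ≠ b) :
    ¬ G.Adj x a ∧ ¬ G.Adj x b := by
  obtain ⟨i, hi⟩ := h.exists_misses hx
  exact ⟨fun hadj => h.not_misses_of_adj_left (deleteEdges_adj_of_ne hadj hxa hxb).symm i hi,
    fun hadj => h.not_misses_of_adj_right (deleteEdges_adj_of_ne hadj hxa hxb).symm i hi⟩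

/-- As `d(b) ≥ Δ/2 + 1`, the neighbourhoods of `b` (without `a`) and `x` have total size at least
3Δ/2 - 1. Both avoid `a, b, x`, so they meet, and `not_misses_of_path` applies. -/
theorem degree_add_one_ne_maxDegree (h : G.IsCriticalColoring a b φ)
    (hsum : G.degree a + G.degree b = G.maxDegree + 2) (hle : G.degree a ≤ G.degree b)
    (hb : G.degree b < G.maxDegree) (hcard : 3 * Fintype.card V ≤ 4 * G.maxDegree + 3) {x : V}
    (hxa : x ≠ a) (hxb : x ≠ b) : G.degree x + 1 ≠ G.maxDegree := by
  classical
  intro hx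
  obtain ⟨i, hi⟩ := h.exists_misses (x := x) (by omega)
  obtain ⟨hxa', hxb'⟩ := h.not_adj_of_degree_lt (x := x) (by omega) hxa hxb
  have hab := h.adj.ne
  have hB : ∀ i, ∃ j, j ≠ i ∧ (G.deleteEdges {s(a, b)}).Misses φ b j := by
    intro i
    have h₁ := h.proper.ncard_misses_add b
    have h₂ := ncard_neighborSet_deleteEdges_add_one h.adj.symm
    rw [Sym2.eq_swap] at h₂
    obtain ⟨j, hj, hji⟩ := Set.exists_ne_of_one_lt_ncard
      (s := {j | (G.deleteEdges {s(a, b)}).Misses φ b j}) (by omega) i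
    exact ⟨j, hji, hj⟩
  obtain ⟨u, hub, hux⟩ : ∃ u, u ∈ (G.neighborFinset b).erase a ∧ u ∈ G.neighborFinset x := by
    by_contra! hno
    have hdisj : Disjoint ((G.neighborFinset b).erase a) (G.neighborFinset x) :=
      Finset.disjoint_left.2 hno
    have hsub : (G.neighborFinset b).erase a ∪ G.neighborFinset x ⊆ Finset.univ \ {a, b, x} := by
      intro w hw
      simp only [Finset.mem_union, Finset.mem_erase, mem_neighborFinset] at hw
      simp only [Finset.mem_sdiff, Finset.mem_univ, true_and, Finset.mem_insert,
        Finset.mem_singleton]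
      rintro (rfl | rfl | rfl) <;> rcases hw with ⟨hw, hw'⟩ | hw
      exacts [hw rfl, hxa' hw, hw'.ne rfl, hxb' hw, hxb' hw'.symm, hw.ne rfl]
    have hc := Finset.card_le_card hsub
    rw [Finset.card_union_of_disjoint hdisj, Finset.card_erase_of_mem (by simpa using h.adj.symm),
      Finset.card_sdiff_of_subset (Finset.subset_univ _), Finset.card_univ,
      Finset.card_eq_three.2 ⟨a, b, x, hab, hxa.symm, hxb.symm, rfl⟩, card_neighborFinset_eq_degree,
      card_neighborFinset_eq_degree] at hc
    omega
  simp only [Finset.mem_erase, mem_neighborFinset] at hub hux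
  have hub' : (G.deleteEdges {s(a, b)}).Adj b u :=
    (deleteEdges_adj_of_ne hub.2.symm hub.1 hub.2.ne').symm
  exact h.not_misses_of_path hub' (deleteEdges_adj_of_ne hux hxa hxb).symm hxa hxb hB i hi

/-- The neighbourhoods of `b`, `x` and `y`, stripped of `a, c, x, y` where necessary, each have at
least Δ - 2 of the n - 4 remaining vertices. An empty triple intersection would give 3(Δ - 2) ≤ 2(n
- 4); a common vertex `u` carries a broom. -/
theorem eq_of_degree_add_one_eq (h : G.IsCriticalColoring a b φ)
    (hsum : G.degree a + G.degree b = G.maxDegree + 2) (hb : G.degree b = G.maxDegree)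
    (hcard : 3 * Fintype.card V ≤ 4 * G.maxDegree + 3) {x y : V}
    (hxa : x ≠ a) (hxb : x ≠ b) (hya : y ≠ a) (hyb : y ≠ b) (hx : G.degree x + 1 = G.maxDegree)
    (hy : G.degree y + 1 = G.maxDegree) : x = y := by
  classical
  by_contra hxy
  obtain ⟨i, hi⟩ := h.exists_misses (x := x) (by omega)
  obtain ⟨j, hj⟩ := h.exists_misses (x := y) (by omega)
  obtain ⟨hxa', hxb'⟩ := h.not_adj_of_degree_lt (x := x) (by omega) hxa hxb
  obtain ⟨hya', hyb'⟩ := h.not_adj_of_degree_lt (x := y) (by omega) hya hyb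
  have hab := h.adj.ne
  have hna := ncard_neighborSet_deleteEdges_add_one h.adj
  obtain ⟨c, hc⟩ := Set.ncard_eq_one.1
    (show ((G.deleteEdges {s(a, b)}).neighborSet a).ncard = 1 by omega)
  have hN : ∀ w, (G.deleteEdges {s(a, b)}).Adj a w ↔ w = c := fun w => by
    rw [← mem_neighborSet, hc, Set.mem_singleton_iff]
  have hca := (hN c).2 rfl
  have hxc : x ≠ c := fun e => h.not_misses_of_adj_left hca i (e ▸ hi)
  have hyc : y ≠ c := fun e => h.not_misses_of_adj_left hca j (e ▸ hj)
  obtain ⟨u, hub, hux, huy⟩ : ∃ u, u ∈ ((G.neighborFinset b).erase a).erase c ∧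
      u ∈ (G.neighborFinset x).erase y ∧ u ∈ (G.neighborFinset y).erase x := by
    by_contra! hno
    set S := ((G.neighborFinset b).erase a).erase c with hS
    set T := (G.neighborFinset x).erase y with hT
    set U := (G.neighborFinset y).erase x with hU
    set W : Finset V := Finset.univ \ {a, b, x, y} with hW
    have hSW : S ⊆ W := by
      intro w hw
      simp only [hS, Finset.mem_erase, mem_neighborFinset] at hw
      simp only [hW, Finset.mem_sdiff, Finset.mem_univ, true_and, Finset.mem_insert,
        Finset.mem_singleton]
      rintro (rfl | rfl | rfl | rfl)
      exacts [hw.2.1 rfl, hw.2.2.ne rfl, hxb' hw.2.2.symm, hyb' hw.2.2.symm]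
    have hTW : T ⊆ W := by
      intro w hw
      simp only [hT, Finset.mem_erase, mem_neighborFinset] at hw
      simp only [hW, Finset.mem_sdiff, Finset.mem_univ, true_and, Finset.mem_insert,
        Finset.mem_singleton]
      rintro (rfl | rfl | rfl | rfl)
      exacts [hxa' hw.2, hxb' hw.2, hw.2.ne rfl, hw.1 rfl]
    have hUW : U ⊆ W := by
      intro w hw
      simp only [hU, Finset.mem_erase, mem_neighborFinset] at hw
      simp only [hW, Finset.mem_sdiff, Finset.mem_univ, true_and, Finset.mem_insert,
        Finset.mem_singleton]
      rintro (rfl | rfl | rfl | rfl)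
      exacts [hya' hw.2, hyb' hw.2, hw.1 rfl, hw.2.ne rfl]
    have hWc : W.card + 4 = Fintype.card V := by
      have h4 : ({a, b, x, y} : Finset V).card = 4 := by
        simp [hab, hxa.symm, hxb.symm, hya.symm, hyb.symm, hxy]
      rw [← h4, hW, Finset.card_sdiff_add_card_eq_card (Finset.subset_univ _), Finset.card_univ]
    have h₁ := Finset.card_le_card (Finset.union_subset hSW hTW)
    have h₂ := Finset.card_union_add_card_inter S T
    have hdisj : Disjoint (S ∩ T) U := Finset.disjoint_left.2 fun w hw =>
      hno w (Finset.mem_inter.1 hw).1 (Finset.mem_inter.1 hw).2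
    have h₃ := Finset.card_le_card (Finset.union_subset (Finset.inter_subset_left.trans hSW) hUW :
      S ∩ T ∪ U ⊆ W)
    rw [Finset.card_union_of_disjoint hdisj] at h₃
    have hSc : G.degree b ≤ S.card + 2 := by
      have e₁ := Finset.pred_card_le_card_erase (s := (G.neighborFinset b).erase a) (a := c)
      have e₂ := Finset.pred_card_le_card_erase (s := G.neighborFinset b) (a := a)
      rw [card_neighborFinset_eq_degree] at e₂
      rw [← hS] at e₁
      omega
    have hTc : G.degree x ≤ T.card + 1 := by
      have e := Finset.pred_card_le_card_erase (s := G.neighborFinset x) (a := y)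
      rw [card_neighborFinset_eq_degree, ← hT] at e
      omega
    have hUc : G.degree y ≤ U.card + 1 := by
      have e := Finset.pred_card_le_card_erase (s := G.neighborFinset y) (a := x)
      rw [card_neighborFinset_eq_degree, ← hU] at e
      omega
    omega
  simp only [Finset.mem_erase, mem_neighborFinset] at hub hux huy
  have hub' : (G.deleteEdges {s(a, b)}).Adj b u :=
    (deleteEdges_adj_of_ne hub.2.2.symm hub.2.1 hub.2.2.ne').symm
  exact h.broom hN hub' hub.1 (deleteEdges_adj_of_ne hux.2 hxa hxb).symm
    (deleteEdges_adj_of_ne huy.2 hya hyb).symm hxy hxa hxb hxc hya hyb hyc hi hj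

end IsCriticalColoring

end FullDeficiency

end SimpleGraph

theorem corollary3p4 {V : Type*} [Fintype V] (G : SimpleGraph V) [DecidableRel G.Adj]
    (n : ℕ) (hn : Fintype.card V = n) (hG : G.IsClassTwo)
    (a b : V) (hab : G.IsFullDeficiencyPair a b) (hcrit : G.IsCriticalEdge s(a, b))
    (hΔ : (G.maxDegree : ℝ) ≥ 3 * ((n : ℝ) - 1) / 4) :
    {x : V | x ∉ ({a, b} : Set V) ∧ (G.degree x : ℤ) = (G.maxDegree : ℤ) - 1}.Subsingleton := by
  obtain ⟨φ, h⟩ := SimpleGraph.exists_isCriticalColoring hG hab hcrit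
  have hcard : 3 * Fintype.card V ≤ 4 * G.maxDegree + 3 := by
    rw [hn]
    have : (3 : ℝ) * n ≤ 4 * G.maxDegree + 3 := by linarith
    exact_mod_cast this
  have hsum := hab.2
  rintro x ⟨hx, hdx⟩ y ⟨hy, hdy⟩
  simp only [Set.mem_insert_iff, Set.mem_singleton_iff, not_or] at hx hy
  have hdx' : G.degree x + 1 = G.maxDegree := by omega
  have hdy' : G.degree y + 1 = G.maxDegree := by omega
  -- An endpoint of degree Δ forces degree two on the other, the broom case. If both are below Δ, no
  -- further vertex of degree Δ - 1 exists at all.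
  rcases (G.degree_le_maxDegree b).eq_or_lt with hb | hb
  · exact h.eq_of_degree_add_one_eq hsum hb hcard hx.1 hx.2 hy.1 hy.2 hdx' hdy'
  rcases (G.degree_le_maxDegree a).eq_or_lt with ha | ha
  · exact h.swap.eq_of_degree_add_one_eq (by omega) ha hcard hx.2 hx.1 hy.2 hy.1 hdx' hdy'
  rcases le_total (G.degree a) (G.degree b) with hle | hle
  · exact absurd hdx' (h.degree_add_one_ne_maxDegree hsum hle hb hcard hx.1 hx.2)
  · exact absurd hdx' (h.swap.degree_add_one_ne_maxDegree (by omega) hle ha hcard hx.2 hx.1)
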